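/- Let $D$ be an integral domain with quotient field $K$. An overring of $D$ is a ring $T$ with $D\subseteq T\subseteq K$; put $\sigma(T)=\{Q\cap D\mid Q\in\operatorname{Spec}T\}$. The Zariski topology on the set of overrings has the sets $\{T\mid x_1,\dots,x_n\in T\}$ ($x_i\in K$) as a subbasis. A family $\Theta$ of overrings of $D$ is a pre-Jaffard family of $D$ if (a) $K\notin\Theta$ or $\Theta=\{K\}$; (b) every $T\in\Theta$ is flat over $D$; (c) $\Theta$ is independent, i.e. $\sigma(A)\cap\sigma(B)=\{(0)\}$ for all $A\neq B$ in $\Theta$; (d) $\Theta$ is complete, i.e. $I=\bigcap_{T\in\Theta}IT$ for every ideal $I$ of $D$; (e) $\Theta$ is compact in the Zariski topology. It is a Jaffard family of $D$ if (a)--(d) hold and every nonzero $x\in K$ is a unit in all but finitely many $T\in\Theta$. A Jaffard overring of $D$ is a member of some Jaffard family of $D$. Let $\Theta$ be a pre-Jaffard family of $D$ (for instance, a Jaffard family). Define $T_\alpha$ and $\Theta_\alpha$ for every ordinal $\alpha$ by $T_0=D$, $\Theta_0=\Theta$; $\Theta_{\gamma+1}=\{T\in\Theta_\gamma\mid T\text{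 is not a Jaffard overring of }T_\gamma\}$; $\Theta_\alpha=\bigcap_{\beta<\alpha}\Theta_\beta$ for a limit ordinal $\alpha$; and $T_\alpha=\bigcap_{S\in\Theta_\alpha}S$ for $\alpha>0$, where $T_\alpha=K$ if $\Theta_\alpha=\emptyset$. Fix an ordinal $\alpha$ and let $\Theta'=(\Theta\setminus\Theta_\alpha)\cup\{T_\alpha\}$. A stable semistar operation on a domain $A$ with quotient field $K$ is a map $I\mapsto I^\star$ on the $A$-submodules of $K$ such that $I\subseteq I^\star$; $I\subseteq J$ implies $I^\star\subseteq J^\star$; $(I^\star)^\star=I^\star$; $x\cdot I^\star=(xI)^\star$ for every $x\in K$; and $(I\cap J)^\star=I^\star\cap J^\star$. The set $\mathrm{Stab}(A)$ of these is ordered by $\star_1\le\star_2$ iff $I^{\star_1}\subseteq I^{\star_2}$ for all $I$. A length function on $A$ is a function $\ell$ from $A$-modules to $[0,\infty]$ with $\ell(0)=0$, additive on short exact sequences, and with $\ell(M)=\sup\{\ell(N)\mid N\subseteq M\text{ finitely generated}\}$; it is singular if it takes only the values $0$ and $\infty$. Let $\mathcal L_{\mathrm{sing}}(A)$ be the set of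 the singular length functions on $A$ that are not identically $0$, ordered pointwise. Then: 1. For every $\star\in\mathrm{Stab}(D)$ and every $D$-submodule $I$ of $K$, $I^\star=\bigcap_{T\in\Theta'}(IT)^\star$. 2. The restriction map $\star\mapsto(\star|_{T\text{-submodules of }K})_{T\in\Theta'}$ is an order isomorphism $\mathrm{Stab}(D)\cong\prod_{T\in\Theta'}\mathrm{Stab}(T)$, and its inverse is the extension map, which sends $(\star^{(T)})_{T\in\Theta'}$ to $I\mapsto\bigcap_{T\in\Theta'}(IT)^{\star^{(T)}}$. 3. For every singular length function $\ell$ on $D$ and every $D$-module $M$, $\ell(M)=\sum_{T\in\Theta'}\ell(M\otimes_DT)$. 4. Restriction of scalars, $\ell\mapsto(\ell|_{T\text{-modules}})_{T\in\Theta'}$, is an order isomorphism $\mathcal L_{\mathrm{sing}}(D)\cong\prod_{T\in\Theta'}\mathcal L_{\mathrm{sing}}(T)$, and its inverse sends $(\ell^{(T)})_{T\in\Theta'}$ to $M\mapsto\sum_{T\in\Theta'}\ell^{(T)}(M\otimes_DT)$. -/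

import Mathlib

open scoped Pointwise ENNReal

universe u v

noncomputable section

namespace PreJaffard

/-! Throughout, `K` is a field. A domain with quotient field `K` is given as a subring `A` of `K`
(with `IsFractionRing A K`), and the overrings of `A` are the subrings `T` of `K` with `A ≤ T`. -/

section Families

variable {K : Type u} [Field K]

/-- `T` is an overring of `A` that is flat as an `A`-module. -/
def IsFlatOverring (A T : Subring K) : Prop :=
  ∃ h : A ≤ T, (Subring.inclusion h).Flat

/-- The set `σ(T)` of the primes `Q ∩ A` of `A`, where `Q` ranges over the primes of `T`. -/
def contractions (A T : Subring K) : Set (PrimeSpectrum A) :=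
  {P | ∃ Q : PrimeSpectrum T,
    (Subtype.val '' (P.asIdeal : Set A) : Set K) =
      (Subtype.val '' (Q.asIdeal : Set T)) ∩ (A : Set K)}

/-- `Θ` is complete: `I = ⋂ {IT | T ∈ Θ}` for every ideal `I` of `A`. -/
def IsComplete (A : Subring K) (Θ : Set (Subring K)) : Prop :=
  ∀ I : Ideal A, (Subtype.val '' (I : Set A) : Set K) =
    ⋂ T ∈ Θ, (Submodule.span T (Subtype.val '' (I : Set A) : Set K) : Set K)

/-- `Θ` is independent: distinct members have only the zero prime in common. -/
def IsIndependent (A : Subring K) (Θ : Set (Subring K)) : Prop :=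
  ∀ S ∈ Θ, ∀ T ∈ Θ, S ≠ T → ∀ P : PrimeSpectrum A,
    P ∈ contractions A S ∩ contractions A T ↔ P.asIdeal = ⊥

/-- `Θ` is locally finite: each nonzero `x ∈ K` is a unit in all but finitely many members. -/
def IsLocallyFinite (Θ : Set (Subring K)) : Prop :=
  ∀ x : K, x ≠ 0 → {T ∈ Θ | ¬ (x ∈ T ∧ x⁻¹ ∈ T)}.Finite

variable (K) in
/-- The Zariski topology on the subrings of `K`, with the sets `{T | x₁, …, xₙ ∈ T}` as a subbasis.
It induces the Zariski topology on the set of overrings of each subring. -/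
@[reducible]
def zariskiTopology : TopologicalSpace (Subring K) :=
  TopologicalSpace.generateFrom {U | ∃ F : Finset K, U = {T : Subring K | (F : Set K) ⊆ (T : Set K)}}

/-- `Θ` is a Jaffard family of `A`. -/
structure IsJaffardFamily (A : Subring K) (Θ : Set (Subring K)) : Prop where
  top_notMem_or : ⊤ ∉ Θ ∨ Θ = {⊤}
  flat : ∀ T ∈ Θ, IsFlatOverring A T
  complete : IsComplete A Θ
  independent : IsIndependent A Θ
  locallyFinite : IsLocallyFinite Θ

/-- `T` is a Jaffard overring of `A`: it belongs to some Jaffard family of `A`. -/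
def IsJaffardOverring (A T : Subring K) : Prop :=
  ∃ Θ : Set (Subring K), IsJaffardFamily A Θ ∧ T ∈ Θ

/-- `Θ` is a pre-Jaffard family of `A`. -/
structure IsPreJaffardFamily (A : Subring K) (Θ : Set (Subring K)) : Prop where
  top_notMem_or : ⊤ ∉ Θ ∨ Θ = {⊤}
  flat : ∀ T ∈ Θ, IsFlatOverring A T
  independent : IsIndependent A Θ
  complete : IsComplete A Θ
  compact : @IsCompact _ (zariskiTopology K) Θ

/-- The pairs `(T_α, Θ_α)`, by transfinite recursion. The intersection of the empty family is
`sInf ∅ = ⊤`, that is, `K`. -/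
def derivedPair (A : Subring K) (Θ : Set (Subring K)) (α : Ordinal.{v}) :
    Subring K × Set (Subring K) :=
  Ordinal.limitRecOn α (A, Θ)
    (fun _ p => (sInf (p.2 \ {T | IsJaffardOverring p.1 T}), p.2 \ {T | IsJaffardOverring p.1 T}))
    (fun β _ p => (sInf (⋂ (γ) (h : γ < β), (p γ h).2), ⋂ (γ) (h : γ < β), (p γ h).2))

/-- The ring `T_α` of the derived sequence of `Θ`. -/
def derivedRing (A : Subring K) (Θ : Set (Subring K)) (α : Ordinal.{v}) : Subring K :=
  (derivedPair A Θ α).1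

/-- The subfamily `Θ_α` of `Θ`. -/
def derivedFamily (A : Subring K) (Θ : Set (Subring K)) (α : Ordinal.{v}) : Set (Subring K) :=
  (derivedPair A Θ α).2

/-- The family `Θ' = (Θ \ Θ_α) ∪ {T_α}`. -/
def truncation (A : Subring K) (Θ : Set (Subring K)) (α : Ordinal.{v}) : Set (Subring K) :=
  (Θ \ derivedFamily A Θ α) ∪ {derivedRing A Θ α}

theorem derived_subset_and_le (A : Subring K) (Θ : Set (Subring K)) (hA : ∀ T ∈ Θ, A ≤ T)
    (α : Ordinal.{v}) : derivedFamily A Θ α ⊆ Θ ∧ A ≤ derivedRing A Θ α := by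
  unfold derivedFamily derivedRing
  induction α using Ordinal.limitRecOn with
  | zero => simp [derivedPair]
  | add_one β ih =>
    have h : (derivedPair A Θ (β + 1)).2 ⊆ Θ := by
      simp only [derivedPair, Ordinal.limitRecOn_add_one]
      exact fun T hT => ih.1 hT.1
    refine ⟨h, ?_⟩
    have e : (derivedPair A Θ (β + 1)).1 = sInf (derivedPair A Θ (β + 1)).2 := by
      simp only [derivedPair, Ordinal.limitRecOn_add_one]
    rw [e]
    exact le_sInf fun T hT => hA T (h hT)
  | limit β hβ ih =>
    have h : (derivedPair A Θ β).2 ⊆ Θ := by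
      rw [derivedPair, Ordinal.limitRecOn_limit _ _ _ _ hβ]
      intro T hT
      have h0 : (0 : Ordinal.{v}) < β := hβ.bot_lt
      exact (ih 0 h0).1 (Set.mem_iInter₂.1 hT 0 h0)
    refine ⟨h, ?_⟩
    have e : (derivedPair A Θ β).1 = sInf (derivedPair A Θ β).2 := by
      rw [derivedPair, Ordinal.limitRecOn_limit _ _ _ _ hβ]
    rw [e]
    exact le_sInf fun T hT => hA T (h hT)

theorem IsPreJaffardFamily.le_of_mem_truncation {A : Subring K} {Θ : Set (Subring K)}
    (hΘ : IsPreJaffardFamily A Θ) {α : Ordinal.{v}} {T : Subring K} (hT : T ∈ truncation A Θ α) :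
    A ≤ T := by
  have hA : ∀ T ∈ Θ, A ≤ T := fun T hT => (hΘ.flat T hT).1
  rcases hT with hT | hT
  · exact hA T hT.1
  · rw [Set.mem_singleton_iff.1 hT]
    exact (derived_subset_and_le A Θ hA α).2

end Families

section Semistar

variable {K : Type u} [Field K]

/-- A `T`-submodule of `K`, seen as an `A`-submodule. -/
def restrict {A T : Subring K} (h : A ≤ T) (J : Submodule T K) : Submodule A K where
  carrier := J
  add_mem' := J.add_mem
  zero_mem' := J.zero_mem
  smul_mem' a _ hx := J.smul_mem (Subring.inclusion h a) hx

/-- The `T`-submodule `IT` of `K`. -/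
def extend {A : Subring K} (T : Subring K) (I : Submodule A K) : Submodule T K :=
  Submodule.span T (I : Set K)

/-- Stable semistar operations on `A`. Here `x • I` is the submodule `xI`, for all `x : K`, zero
included. -/
@[ext]
structure StableSemistar (A : Subring K) where
  toFun : Submodule A K → Submodule A K
  le_toFun' : ∀ I, I ≤ toFun I
  mono' : ∀ I J, I ≤ J → toFun I ≤ toFun J
  idem' : ∀ I, toFun (toFun I) = toFun I
  smul' : ∀ (x : K) (I), x • toFun I = toFun (x • I)
  inf' : ∀ I J, toFun (I ⊓ J) = toFun I ⊓ toFun J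

instance (A : Subring K) : CoeFun (StableSemistar A) fun _ => Submodule A K → Submodule A K :=
  ⟨StableSemistar.toFun⟩

/-- `s ≤ t` if and only if `I^s ⊆ I^t` for all `I`. -/
instance (A : Subring K) : PartialOrder (StableSemistar A) :=
  PartialOrder.lift StableSemistar.toFun fun _ _ h => StableSemistar.ext h

end Semistar

section Length

open CategoryTheory

/-- Length functions on `R`, with values in `[0, ∞]`. -/
@[ext]
structure LengthFunction (R : Type u) [CommRing R] where
  toFun : ModuleCat.{u} R → ℝ≥0∞
  zero' : ∀ M : ModuleCat.{u} R, Subsingleton M → toFun M = 0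
  additive' : ∀ S : ShortComplex (ModuleCat.{u} R), S.ShortExact →
    toFun S.X₂ = toFun S.X₁ + toFun S.X₃
  upperContinuous' : ∀ M : ModuleCat.{u} R,
    toFun M = ⨆ N : {N : Submodule R M // N.FG}, toFun (ModuleCat.of R N.1)

instance (R : Type u) [CommRing R] :
    CoeFun (LengthFunction R) fun _ => ModuleCat.{u} R → ℝ≥0∞ :=
  ⟨LengthFunction.toFun⟩

/-- Length functions are ordered pointwise. -/
instance (R : Type u) [CommRing R] : PartialOrder (LengthFunction R) :=
  PartialOrder.lift LengthFunction.toFun fun _ _ h => LengthFunction.ext h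

/-- A length function is singular if its only values are `0` and `∞`. -/
def LengthFunction.IsSingular {R : Type u} [CommRing R] (ℓ : LengthFunction R) : Prop :=
  ∀ M, ℓ M = 0 ∨ ℓ M = ∞

/-- The set of the singular length functions that do not vanish identically. -/
def SingularLength (R : Type u) [CommRing R] : Type (u + 1) :=
  {ℓ : LengthFunction R // ℓ.IsSingular ∧ ∃ M, ℓ M ≠ 0}

instance (R : Type u) [CommRing R] : PartialOrder (SingularLength R) :=
  inferInstanceAs (PartialOrder {ℓ : LengthFunction R // ℓ.IsSingular ∧ ∃ M, ℓ M ≠ 0})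

variable {K : Type u} [Field K]

/-- A `T`-module, seen as an `A`-module. -/
abbrev restrictModule {A T : Subring K} (h : A ≤ T) (M : ModuleCat.{u} T) : ModuleCat.{u} A :=
  (ModuleCat.restrictScalars (Subring.inclusion h)).obj M

/-- The `T`-module `M ⊗_A T`. -/
abbrev extendModule {A T : Subring K} (h : A ≤ T) (M : ModuleCat.{u} A) : ModuleCat.{u} T :=
  (ModuleCat.extendScalars (Subring.inclusion h)).obj M

end Length

end PreJaffard

end

open PreJaffard

/-! Stable semistar operations and nonzero singular length functions are both encoded by Gabriel
filters of ideals not containing `0`. For a stable operation take the ideals `I` with `1 ∈ I^⋆`;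
then `x ∈ X^⋆` iff `(X : x)` is such an ideal (`semistarIso`). For a length function take the ideals
with `ℓ(R/I) = 0`; then `ℓ(M) = 0` iff the annihilator of each element of `M` is such an ideal
(`LengthFunction.eq_zero_iff`). Colon ideals and annihilators commute with flat extension
(`FlatOver.map_elemColon`, `elemColon_one_tmul`), so all four claims reduce to one fact,
`IsCompactFamily.mem_of_saturation_mem`: a Gabriel filter `F` of `D` contains `I` as soon as it
contains `IT ∩ D` for every `T ∈ Θ'`. Since distinct members of `Θ'` generate `K`, this fact yields
`gabrielIso`, the decomposition of the Gabriel filters of `D`.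

The fact is proved by transfinite induction along `(T_α, Θ_α)`, with the invariant `IsDerivedStage`:
`Θ_α` is a compact flat family over `T_α`, the ring `T_α` is flat over `D` and orthogonal to the
removed members, and `I ∈ F` whenever `I T_α = T_α` and `IT ∩ D ∈ F` for the removed `T`.

At a successor, a Jaffard overring `T` of `B` satisfies `IsSplit`: each nonzero `f ∈ B` gives an `n
∈ B` with `(1 - n)/f ∈ T` and `n/f` in every member of the family other than `T`. A limit of members
different from `T` that contains `T` is therefore `K`. By compactness, an ideal that becomes trivial
in all the remaining members becomes trivial in all but finitely many of the old ones
(`IsCompactFamily.finite_not_covers`), and Gabriel filters are closed under finite intersections. At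
a limit ordinal, compactness shows that an ideal trivial on `Θ_α` is already trivial on some earlier
`Θ_β` (`IsFlatFamily.exists_forall_covers`). -/

noncomputable section

namespace PreJaffard

/-! ### Sets generating the unit ideal of a subring of `K` -/

section Covers

variable {K : Type u} [Field K]

/-- The `T`-submodule of `K` generated by `X` contains `1`. -/
def Covers (X : Set K) (T : Subring K) : Prop :=
  (1 : K) ∈ Submodule.span T X

theorem span_mono_ring {S T : Subring K} (h : S ≤ T) (X : Set K) {x : K}
    (hx : x ∈ Submodule.span S X) : x ∈ Submodule.span T X := by
  induction hx using Submodule.span_induction with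
  | mem x hx => exact Submodule.subset_span hx
  | zero => exact zero_mem _
  | add x y _ _ hx hy => exact add_mem hx hy
  | smul a x _ hx => exact Submodule.smul_mem _ (Subring.inclusion h a) hx

theorem mul_mem_span {T : Subring K} {X : Set K} {t x : K} (ht : t ∈ T)
    (hx : x ∈ Submodule.span T X) : t * x ∈ Submodule.span T X :=
  Submodule.smul_mem _ (⟨t, ht⟩ : T) hx

theorem mul_mem_span_of_forall {T : Subring K} {X Y : Set K} {c y : K}
    (h : ∀ x ∈ X, c * x ∈ Submodule.span T Y) (hy : y ∈ Submodule.span T X) :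
    c * y ∈ Submodule.span T Y := by
  induction hy using Submodule.span_induction with
  | mem x hx => exact h x hx
  | zero => simp
  | add x y _ _ hx hy => rw [mul_add]; exact add_mem hx hy
  | smul a x _ hx =>
    have : c * (a • x) = a • (c * x) := by rw [mul_smul_comm]
    rw [this]
    exact Submodule.smul_mem _ a hx

theorem Covers.mono_ring {S T : Subring K} (h : S ≤ T) {X : Set K} (hX : Covers X S) :
    Covers X T :=
  span_mono_ring h X hX

theorem Covers.mono {T : Subring K} {X Y : Set K} (h : X ⊆ Y) (hX : Covers X T) :
    Covers Y T :=
  Submodule.span_mono h hX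

theorem Covers.of_one_mem {T : Subring K} {X : Set K} (h : (1 : K) ∈ X) : Covers X T :=
  Submodule.subset_span h

theorem Covers.mem_span {T : Subring K} {X Y : Set K} (hX : Covers X T) {c : K}
    (h : ∀ x ∈ X, c * x ∈ Submodule.span T Y) : c ∈ Submodule.span T Y := by
  simpa using mul_mem_span_of_forall h hX

theorem Covers.trans {T : Subring K} {X Y : Set K} (hX : Covers X T)
    (h : ∀ x ∈ X, x ∈ Submodule.span T Y) : Covers Y T :=
  hX.mem_span (c := 1) (by simpa using h)

theorem Covers.mul {T : Subring K} {X Y Z : Set K} (hX : Covers X T) (hY : Covers Y T)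
    (h : ∀ x ∈ X, ∀ y ∈ Y, x * y ∈ Z) : Covers Z T :=
  hX.trans fun x hx => hY.mem_span fun y hy => Submodule.subset_span (h x hx y hy)

theorem Covers.of_inv_mem {T : Subring K} {X : Set K} {f : K} (hf : f ∈ X) (h0 : f ≠ 0)
    (h : f⁻¹ ∈ T) : Covers X T := by
  have := mul_mem_span h (Submodule.subset_span (R := T) hf)
  rwa [inv_mul_cancel₀ h0] at this

theorem Covers.exists_ne_zero {T : Subring K} {X : Set K} (h : Covers X T) :
    ∃ f ∈ X, f ≠ 0 := by
  by_contra! H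
  have : Submodule.span T X = ⊥ := Submodule.span_eq_bot.2 H
  rw [Covers, this] at h
  exact one_ne_zero ((Submodule.mem_bot T).1 h)

/-- The set `IT ∩ A`, for an ideal `I` of `A`, as an ideal of `A`. -/
def saturation {A : Subring K} (I : Ideal A) (T : Subring K) (h : A ≤ T) : Ideal A :=
  (I.map (Subring.inclusion h)).comap (Subring.inclusion h)

theorem mem_map_inclusion_iff {A T : Subring K} (h : A ≤ T) (I : Ideal A) (x : T) :
    x ∈ I.map (Subring.inclusion h) ↔
      (x : K) ∈ Submodule.span T (Subtype.val '' (I : Set A) : Set K) := by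
  have : (Submodule.span T (Subtype.val '' (I : Set A) : Set K)) =
      Submodule.map (Algebra.linearMap T K) (I.map (Subring.inclusion h)) := by
    rw [Ideal.map, Ideal.span, Submodule.map_span, ← Set.image_comp]
    rfl
  rw [this, Submodule.mem_map]
  constructor
  · intro hx
    exact ⟨x, hx, rfl⟩
  · rintro ⟨y, hy, hxy⟩
    have : y = x := Subtype.ext hxy
    rwa [← this]

theorem map_inclusion_eq_top_iff {A T : Subring K} (h : A ≤ T) (I : Ideal A) :
    I.map (Subring.inclusion h) = ⊤ ↔ Covers (Subtype.val '' (I : Set A)) T := by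
  rw [Ideal.eq_top_iff_one, mem_map_inclusion_iff]
  rfl

theorem mem_saturation_iff {A T : Subring K} (h : A ≤ T) (I : Ideal A) (x : A) :
    x ∈ saturation I T h ↔
      (x : K) ∈ Submodule.span T (Subtype.val '' (I : Set A) : Set K) := by
  rw [saturation, Ideal.mem_comap, mem_map_inclusion_iff]
  rfl

end Covers

/-! ### Flat overrings through conductors -/

section Flat

variable {K : Type u} [Field K]

/-- The elementary form of flatness for an overring `T` of `A`: the conductor of each `x ∈ T` into
`A` generates the unit ideal of `T`. -/
def FlatOver (A T : Subring K) : Prop :=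
  A ≤ T ∧ ∀ x ∈ T, Covers {a | a ∈ A ∧ a * x ∈ A} T

/-- Flat extension commutes with colons, and `(XT : y)` is all of `T`. Along the generation of `y`,
the multipliers obtained so far are multiplied together. -/
theorem FlatOver.covers_colon {A T : Subring K} (h : FlatOver A T) (X : Submodule A K) {y : K}
    (hy : y ∈ Submodule.span T (X : Set K)) : Covers {a | a ∈ A ∧ a * y ∈ X} T := by
  have hA : ∀ a ∈ A, ∀ x ∈ X, a * x ∈ X := fun a ha x hx => X.smul_mem (⟨a, ha⟩ : A) hx
  induction hy using Submodule.span_induction with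
  | mem x hx => exact Covers.of_one_mem ⟨A.one_mem, by simpa using hx⟩
  | zero => exact Covers.of_one_mem ⟨A.one_mem, by simp⟩
  | add x y _ _ hx hy =>
    refine hx.mul hy fun a ha b hb => ⟨A.mul_mem ha.1 hb.1, ?_⟩
    have : a * b * (x + y) = b * (a * x) + a * (b * y) := by ring
    rw [this]
    exact X.add_mem (hA _ hb.1 _ ha.2) (hA _ ha.1 _ hb.2)
  | smul t x _ hx =>
    refine (h.2 t t.2).mul hx fun a ha b hb => ⟨A.mul_mem ha.1 hb.1, ?_⟩
    have : a * b * (t • x) = (a * t) * (b * x) := by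
      rw [Subring.smul_def, smul_eq_mul]; ring
    rw [this]
    exact hA _ ha.2 _ hb.2

theorem FlatOver.covers_finite {A T : Subring K} (h : FlatOver A T) {ι : Type*} (s : Finset ι)
    (x : ι → K) (hx : ∀ i, x i ∈ T) : Covers {a | a ∈ A ∧ ∀ i ∈ s, a * x i ∈ A} T := by
  classical
  induction s using Finset.induction_on with
  | empty => exact Covers.of_one_mem ⟨A.one_mem, by simp⟩
  | insert i s _ ih =>
    refine ih.mul (h.2 _ (hx i)) fun a ha b hb => ⟨A.mul_mem ha.1 hb.1, fun j hj => ?_⟩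
    rcases Finset.mem_insert.1 hj with rfl | hj
    · rw [mul_assoc]; exact A.mul_mem ha.1 hb.2
    · rw [mul_right_comm]; exact A.mul_mem (ha.2 j hj) hb.1

theorem FlatOver.of_le {A B T : Subring K} (h : FlatOver A T) (hAB : A ≤ B) (hBT : B ≤ T) :
    FlatOver B T :=
  ⟨hBT, fun x hx => (h.2 x hx).mono fun _ ha => ⟨hAB ha.1, hAB ha.2⟩⟩

theorem FlatOver.refl (A : Subring K) : FlatOver A A :=
  ⟨le_rfl, fun _ hx => Covers.of_one_mem ⟨A.one_mem, by simpa using hx⟩⟩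

/-- A subring of `K`, as a submodule over a smaller subring. -/
def ringSubmodule {A T : Subring K} (h : A ≤ T) : Submodule A K where
  carrier := T
  add_mem' := T.add_mem
  zero_mem' := T.zero_mem
  smul_mem' a _ hx := T.mul_mem (h a.2) hx

theorem FlatOver.trans {A B T : Subring K} (h : FlatOver A B) (h' : FlatOver B T) :
    FlatOver A T := by
  refine ⟨h.1.trans h'.1, fun x hx => (h'.2 x hx).trans fun b hb => ?_⟩
  have h1 := (h.2 _ hb.1).mono_ring h'.1
  have h2 := (h.2 _ hb.2).mono_ring h'.1
  -- Multipliers clearing `b` and `b * x` at once turn `b` into elements `b * a` of the conductor of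
  -- `x` into `A`.
  have h3 : Covers {a | a ∈ A ∧ a * b ∈ A ∧ a * (b * x) ∈ A} T := by
    refine h1.mul h2 fun a ha c hc => ⟨A.mul_mem ha.1 hc.1, ?_, ?_⟩
    · rw [mul_right_comm]; exact A.mul_mem ha.2 hc.1
    · rw [mul_assoc]; exact A.mul_mem ha.1 hc.2
  refine h3.mem_span fun a ha => Submodule.subset_span ⟨?_, ?_⟩
  · rw [mul_comm]; exact ha.2.1
  · have : b * a * x = a * (b * x) := by ring
    rw [this]; exact ha.2.2

theorem exists_sum_of_flat {R M : Type*} [CommRing R] [AddCommGroup M] [Module R M]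
    [Module.Flat R M] {a b : R} {u x : M} (hab : a • u = b • x) :
    ∃ (k : ℕ) (c d : Fin k → R) (y : Fin k → M),
      u = ∑ j, c j • y j ∧ ∀ j, a * c j = b * d j := by
  have hfz : ∑ i, (![a, -b] : Fin 2 → R) i • (![u, x] : Fin 2 → M) i = 0 := by
    rw [Fin.sum_univ_two]
    simp [hab]
  have H : Module.IsTrivialRelation ![a, -b] ![u, x] :=
    Module.Flat.isTrivialRelation_of_sum_smul_eq_zero hfz
  obtain ⟨k, c, y, hy, hay⟩ := H
  refine ⟨k, c 0, c 1, y, hy 0, fun j => ?_⟩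
  have := hay j
  rw [Fin.sum_univ_two] at this
  simp only [Matrix.cons_val_zero, Matrix.cons_val_one] at this
  linear_combination this

/-- With `b` a denominator of `x`, the equational criterion trivializes the relation `(bx) · 1 = b ·
x`: it writes `1 = ∑ c_j y_j` with `(bx) c_j = b d_j`, so each `c_j` conducts `x` into `A`. -/
theorem flatOver_of_isFlatOverring {A T : Subring K}
    (hA : ∀ x : K, ∃ b ∈ A, b ≠ 0 ∧ b * x ∈ A) (h : IsFlatOverring A T) : FlatOver A T := by
  obtain ⟨hle, hf⟩ := h
  refine ⟨hle, fun x hx => ?_⟩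
  obtain ⟨b, hb, hb0, hbx⟩ := hA x
  let := (Subring.inclusion hle).toAlgebra
  have h' : Module.Flat A T := hf
  obtain ⟨k, c, d, y, h1, hcd⟩ := exists_sum_of_flat (R := A) (M := T)
    (a := ⟨b * x, hbx⟩) (b := ⟨b, hb⟩) (u := 1) (x := ⟨x, hx⟩) (Subtype.ext (mul_one _))
  have h1 : (1 : K) = ∑ j, (y j) • (c j : K) := by
    have := congrArg (Subtype.val : T → K) h1
    rw [AddSubmonoidClass.coe_finsetSum] at this
    exact this.trans (Finset.sum_congr rfl fun j _ => mul_comm (c j : K) (y j : K))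
  rw [Covers, h1]
  refine sum_mem fun j _ => Submodule.smul_mem _ _ (Submodule.subset_span ⟨(c j).2, ?_⟩)
  have h3 : b * x * c j = b * d j := congrArg (Subtype.val : A → K) (hcd j)
  have h2 : (c j : K) * x = d j := by
    apply mul_left_cancel₀ hb0
    linear_combination h3
  rw [h2]
  exact (d j).2

/-- Write `1 = ∑ y_j g_j` with each `g_j` conducting all the `x_i` into `A`; then `x_i = ∑ (g_j x_i)
y_j` trivializes any relation among the `x_i`. -/
theorem FlatOver.flat {A T : Subring K} (h : FlatOver A T) :
    (Subring.inclusion h.1).Flat := by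
  let := (Subring.inclusion h.1).toAlgebra
  change Module.Flat A T
  have hs : ∀ (a : A) (t : T), ((a • t : T) : K) = (a : K) * t := fun a t => rfl
  refine Module.Flat.of_forall_isTrivialRelation fun {l f x} hfx => ?_
  have hc := h.covers_finite Finset.univ (fun i => (x i : K)) fun i => (x i).2
  obtain ⟨k, y, g, hg⟩ := Submodule.mem_span_set'.1 hc
  refine ⟨k, fun i j => ⟨g j * x i, (g j).2.2 i (Finset.mem_univ i)⟩, y, fun i => ?_, fun j => ?_⟩
  · apply Subtype.ext
    rw [AddSubmonoidClass.coe_finsetSum]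
    simp only [hs]
    calc (x i : K) = (∑ j, y j • (g j : K)) * x i := by rw [hg, one_mul]
      _ = _ := by
        rw [Finset.sum_mul]
        refine Finset.sum_congr rfl fun j _ => ?_
        rw [Subring.smul_def, smul_eq_mul]; ring
  · apply Subtype.ext
    have := congrArg (Subtype.val : T → K) hfx
    rw [AddSubmonoidClass.coe_finsetSum] at this ⊢
    simp only [hs, Subring.coe_zero, Subring.coe_mul] at this ⊢
    calc ∑ i, (f i : K) * (g j * x i) = g j * ∑ i, (f i : K) * x i := by
          rw [Finset.mul_sum]
          exact Finset.sum_congr rfl fun i _ => by ring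
      _ = 0 := by rw [this, mul_zero]

theorem mem_span_of_sup_eq_top {S T : Subring K} (h : S ⊔ T = ⊤) (x : K) :
    x ∈ Submodule.span S (T : Set K) := by
  have h1 : (Algebra.adjoin S (T : Set K)).toSubring = ⊤ := by
    rw [eq_top_iff, ← h]
    refine sup_le (fun s hs => ?_) fun t ht => ?_
    · exact (Algebra.adjoin S (T : Set K)).algebraMap_mem (⟨s, hs⟩ : S)
    · exact Algebra.subset_adjoin ht
  have h2 : x ∈ Subalgebra.toSubmodule (Algebra.adjoin S (T : Set K)) := by
    have : x ∈ (Algebra.adjoin S (T : Set K)).toSubring := by rw [h1]; trivial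
    exact this
  rw [Algebra.adjoin_eq_span] at h2
  have h3 : Submonoid.closure (T : Set K) = T.toSubmonoid :=
    Submonoid.closure_eq T.toSubmonoid
  rw [h3] at h2
  exact h2

/-- Here `K` is the `S`-span of `T`, so this is the colon lemma for the `A`-module `T`. -/
theorem FlatOver.covers_of_sup_eq_top {A S T : Subring K} (hS : FlatOver A S) (hT : A ≤ T)
    (h : S ⊔ T = ⊤) (x : K) : Covers {a | a ∈ A ∧ a * x ∈ T} S :=
  hS.covers_colon (ringSubmodule hT) (mem_span_of_sup_eq_top h x)

end Flat

/-! ### Colon ideals and Gabriel filters -/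

section Colon

/-- The ideal of the scalars that multiply `m` into `N`. -/
def elemColon {R M : Type*} [CommRing R] [AddCommGroup M] [Module R M] (N : Submodule R M) (m : M) :
    Ideal R :=
  N.comap (LinearMap.toSpanSingleton R M m)

theorem mem_elemColon {R M : Type*} [CommRing R] [AddCommGroup M] [Module R M]
    {N : Submodule R M} {m : M} {a : R} : a ∈ elemColon N m ↔ a • m ∈ N := Iff.rfl

theorem le_elemColon {R : Type*} [CommRing R] (I : Ideal R) (y : R) : I ≤ elemColon I y :=
  fun _ ha => I.mul_mem_right y ha

/-- A Gabriel filter of ideals of `R` that does not contain the zero ideal. -/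
@[ext]
structure GabrielFilter (R : Type*) [CommRing R] where
  sets : Set (Ideal R)
  top_mem' : ⊤ ∈ sets
  mono' : ∀ I J, I ∈ sets → I ≤ J → J ∈ sets
  gabriel' : ∀ J ∈ sets, ∀ I, (∀ y ∈ J, elemColon I y ∈ sets) → I ∈ sets
  bot_notMem' : ⊥ ∉ sets

variable {R : Type*} [CommRing R]

instance : Membership (Ideal R) (GabrielFilter R) := ⟨fun F I => I ∈ F.sets⟩

instance : PartialOrder (GabrielFilter R) :=
  PartialOrder.lift GabrielFilter.sets fun _ _ h => GabrielFilter.ext h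

namespace GabrielFilter

theorem top_mem (F : GabrielFilter R) : ⊤ ∈ F := F.top_mem'

theorem mono (F : GabrielFilter R) {I J : Ideal R} (hI : I ∈ F) (h : I ≤ J) : J ∈ F :=
  F.mono' I J hI h

theorem mem_of_forall_elemColon (F : GabrielFilter R) {I J : Ideal R} (hJ : J ∈ F)
    (h : ∀ y ∈ J, elemColon I y ∈ F) : I ∈ F :=
  F.gabriel' J hJ I h

theorem bot_notMem (F : GabrielFilter R) : ⊥ ∉ F := F.bot_notMem'

theorem mul_mem (F : GabrielFilter R) {I J : Ideal R} (hI : I ∈ F) (hJ : J ∈ F) : I * J ∈ F :=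
  F.mem_of_forall_elemColon hI fun y hy => F.mono hJ fun a ha => by
    rw [mem_elemColon, smul_eq_mul, mul_comm a y]
    exact Ideal.mul_mem_mul hy ha

theorem inf_mem (F : GabrielFilter R) {I J : Ideal R} (hI : I ∈ F) (hJ : J ∈ F) : I ⊓ J ∈ F :=
  F.mono (F.mul_mem hI hJ) Ideal.mul_le_inf

theorem finset_inf_mem (F : GabrielFilter R) {ι : Type*} (s : Finset ι) (I : ι → Ideal R)
    (h : ∀ i ∈ s, I i ∈ F) : s.inf I ∈ F := by
  classical
  induction s using Finset.induction_on with
  | empty => exact F.top_mem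
  | insert i s _ ih =>
    rw [Finset.inf_insert]
    exact F.inf_mem (h i (Finset.mem_insert_self i s))
      (ih fun j hj => h j (Finset.mem_insert_of_mem hj))

end GabrielFilter

end Colon

/-! ### Orthogonal flat families, splitting and ultrafilter limits -/

section Families

variable {K : Type u} [Field K]

/-- A family of flat overrings that is complete with respect to nonzero ideals and whose members
are pairwise orthogonal. -/
structure IsFlatFamily (A : Subring K) (Θ : Set (Subring K)) : Prop where
  frac : ∀ x : K, ∃ b ∈ A, b ≠ 0 ∧ b * x ∈ A
  flat : ∀ T ∈ Θ, FlatOver A T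
  sup_eq_top : ∀ S ∈ Θ, ∀ T ∈ Θ, S ≠ T → S ⊔ T = ⊤
  complete : ∀ I : Ideal A, I ≠ ⊥ → (∀ T ∈ Θ, Covers (Subtype.val '' (I : Set A)) T) → I = ⊤

/-- The subring `T` of `K` is contained in the limit of `U`. -/
def IsLimit (U : Ultrafilter (Subring K)) (T : Subring K) : Prop :=
  ∀ x ∈ T, ∀ᶠ S : Subring K in U, x ∈ S

/-- A flat family in which each ultrafilter has a limit. -/
structure IsCompactFamily (A : Subring K) (Θ : Set (Subring K)) : Prop
    extends IsFlatFamily A Θ where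
  compact : ∀ U : Ultrafilter (Subring K), (∀ᶠ S in U, S ∈ Θ) → ∃ T ∈ Θ, IsLimit U T

variable {A : Subring K} {Θ : Set (Subring K)}

/-- Completeness passes from ideals to nonzero submodules of `K`: apply it to the ideal `(X : y)`,
which generates every member by flatness. -/
theorem IsFlatFamily.mem_of_forall_mem_span (h : IsFlatFamily A Θ) {X : Submodule A K}
    (hX : X ≠ ⊥) {y : K} (hy : ∀ T ∈ Θ, y ∈ Submodule.span T (X : Set K)) : y ∈ X := by
  have htop : elemColon X y = ⊤ := by
    apply h.complete
    · obtain ⟨x, hx, hx0⟩ := X.ne_bot_iff.1 hX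
      obtain ⟨b, hb, hb0, hbx⟩ := h.frac (y / x)
      refine (Submodule.ne_bot_iff _).2 ⟨⟨b, hb⟩, ?_, fun hb' => hb0 (congrArg Subtype.val hb')⟩
      have : b * y = b * (y / x) * x := by field_simp
      rw [mem_elemColon, Subring.smul_def, smul_eq_mul, this]
      exact X.smul_mem (⟨_, hbx⟩ : A) hx
    · intro T hT
      refine ((h.flat T hT).covers_colon X (hy T hT)).mono ?_
      rintro a ⟨ha, hay⟩
      exact ⟨⟨a, ha⟩, hay, rfl⟩
  have : (1 : A) ∈ elemColon X y := by rw [htop]; trivial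
  simpa [mem_elemColon] using this

theorem ringSubmodule_ne_bot {A T : Subring K} (h : A ≤ T) : ringSubmodule h ≠ ⊥ :=
  (Submodule.ne_bot_iff _).2 ⟨1, T.one_mem, one_ne_zero⟩

theorem IsFlatFamily.mem_of_forall_mem (h : IsFlatFamily A Θ) {y : K} (hy : ∀ T ∈ Θ, y ∈ T) :
    y ∈ A := by
  refine h.mem_of_forall_mem_span (X := ringSubmodule le_rfl) (ringSubmodule_ne_bot _)
    fun T hT => ?_
  have := mul_mem_span (X := (ringSubmodule (le_refl A) : Set K)) (hy T hT)
    (Submodule.subset_span (R := T) A.one_mem)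
  rwa [mul_one] at this

/-- For each nonzero `f ∈ A`, the ideals `fT ∩ A` and `(fA : fT ∩ A)` of `A` are comaximal. -/
def IsSplit (A T : Subring K) : Prop :=
  ∀ f ∈ A, f ≠ 0 → ∃ n ∈ A, (1 - n) * f⁻¹ ∈ T ∧ ∀ d ∈ A, d * f⁻¹ ∈ T → n * d * f⁻¹ ∈ A

/-- Put `M_V = fV ∩ A`. It generates every `W ≠ V` by orthogonality, so `M_T` is comaximal with each
other `M_V`, hence with the product of those finitely many for which `f` is not a unit in `V`. -/
theorem IsFlatFamily.isSplit (h : IsFlatFamily A Θ) (hfin : IsLocallyFinite Θ) {T : Subring K}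
    (hT : T ∈ Θ) : IsSplit A T := by
  classical
  intro f hf hf0
  let M : Θ → Ideal A := fun V => elemColon (ringSubmodule (h.flat V V.2).1) f⁻¹
  have hM : ∀ V (a : A), a ∈ M V ↔ (a : K) * f⁻¹ ∈ V.1 := fun V a => Iff.rfl
  have hcov : ∀ V W : Θ, W ≠ V → Covers (Subtype.val '' (M V : Set A)) W := by
    intro V W hVW
    refine ((h.flat W W.2).covers_of_sup_eq_top (h.flat V V.2).1 (h.sup_eq_top W W.2 V V.2
      fun h => hVW (Subtype.ext h)) f⁻¹).mono ?_
    rintro a ⟨ha, haf⟩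
    exact ⟨⟨a, ha⟩, haf, rfl⟩
  have hcop : ∀ V : Θ, V ≠ ⟨T, hT⟩ → M ⟨T, hT⟩ ⊔ M V = ⊤ := by
    intro V hV
    apply h.complete
    · refine (Submodule.ne_bot_iff _).2 ⟨⟨f, hf⟩, Submodule.mem_sup_left ?_,
        fun hb' => hf0 (congrArg Subtype.val hb')⟩
      rw [hM, mul_inv_cancel₀ hf0]
      exact T.one_mem
    · intro W hW
      by_cases hWT : (⟨W, hW⟩ : Θ) = ⟨T, hT⟩
      · exact (hcov V ⟨W, hW⟩ (hWT ▸ hV.symm)).mono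
          (Set.image_mono (le_sup_right : M V ≤ M ⟨T, hT⟩ ⊔ M V))
      · exact (hcov ⟨T, hT⟩ ⟨W, hW⟩ hWT).mono
          (Set.image_mono (le_sup_left : M ⟨T, hT⟩ ≤ M ⟨T, hT⟩ ⊔ M V))
  have hE : {V : Θ | V ≠ ⟨T, hT⟩ ∧ ¬ (f ∈ V.1 ∧ f⁻¹ ∈ V.1)}.Finite :=
    ((hfin f hf0).preimage Subtype.val_injective.injOn).subset fun V hV => ⟨V.2, hV.2⟩
  have htop := Ideal.sup_prod_eq_top (I := M ⟨T, hT⟩) (s := hE.toFinset) (J := M)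
    fun V hV => hcop V (hE.mem_toFinset.1 hV).1
  obtain ⟨m, hm, n, hn, hmn⟩ := Submodule.mem_sup.1
    (show (1 : A) ∈ _ ⊔ _ from htop ▸ Submodule.mem_top)
  have hmn' : (1 : K) - n = m := by
    have : (m : K) + n = 1 := congrArg Subtype.val hmn
    linear_combination -this
  refine ⟨n, n.2, hmn' ▸ hm, fun d hd hdf => h.mem_of_forall_mem fun V hV => ?_⟩
  by_cases hVT : V = T
  · rw [hVT, mul_assoc]
    exact T.mul_mem ((h.flat T hT).1 n.2) hdf
  · have hnV : (n : K) * f⁻¹ ∈ V := by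
      by_cases hfV : f ∈ V ∧ f⁻¹ ∈ V
      · exact V.mul_mem ((h.flat V hV).1 n.2) hfV.2
      · refine Finset.inf_le (f := M) (b := ⟨V, hV⟩) (hE.mem_toFinset.2 ⟨?_, hfV⟩)
          (Ideal.prod_le_inf hn)
        exact fun h => hVT (congrArg Subtype.val h)
    rw [mul_right_comm]
    exact V.mul_mem hnV ((h.flat V hV).1 hd)

/-- The ideal `fT ∩ A` generates `S` by orthogonality, and `n/f` multiplies it into `A ⊆ S`. -/
theorem mul_inv_mem_of_isSplit {S T : Subring K} (hS : FlatOver A S) (hT : A ≤ T)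
    (hST : S ⊔ T = ⊤) {f n : K} (hn : ∀ d ∈ A, d * f⁻¹ ∈ T → n * d * f⁻¹ ∈ A) :
    n * f⁻¹ ∈ S := by
  have h1 := (hS.covers_of_sup_eq_top hT hST f⁻¹).mem_span (c := n * f⁻¹)
    (Y := ringSubmodule hS.1) fun d hd => Submodule.subset_span (hS.1 (by
      rw [mul_right_comm]; exact hn d hd.1 hd.2))
  have h2 : Submodule.span S ((ringSubmodule hS.1 : Submodule A K) : Set K) =
      ringSubmodule (le_refl S) :=
    Submodule.span_eq (ringSubmodule (le_refl S))
  rw [h2] at h1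
  exact h1

theorem IsLimit.eventually_mem_span {U : Ultrafilter (Subring K)} {T : Subring K}
    (h : IsLimit U T) {X : Set K} {y : K} (hy : y ∈ Submodule.span T X) :
    ∀ᶠ S : Subring K in U, y ∈ Submodule.span S X := by
  induction hy using Submodule.span_induction with
  | mem x hx => exact Filter.Eventually.of_forall fun S => Submodule.subset_span hx
  | zero => exact Filter.Eventually.of_forall fun S => zero_mem _
  | add x y _ _ hx hy => exact (hx.and hy).mono fun S hS => add_mem hS.1 hS.2
  | smul a x _ hx => exact ((h a a.2).and hx).mono fun S hS => mul_mem_span hS.1 hS.2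

theorem IsFlatFamily.isLimit_top_of_isSplit (h : IsFlatFamily A Θ) {T : Subring K} (hT : T ∈ Θ)
    (hs : IsSplit A T) {U : Ultrafilter (Subring K)} (hU : ∀ᶠ S in U, S ∈ Θ ∧ S ≠ T)
    (hUT : IsLimit U T) : IsLimit U ⊤ := by
  intro x _
  obtain ⟨b, hb, hb0, hbx⟩ := h.frac x
  obtain ⟨n, hn, hnT, hnd⟩ := hs b hb hb0
  filter_upwards [hU, hUT _ hnT] with S hS hS'
  have hle := (h.flat S hS.1).1
  have h1 : n * b⁻¹ ∈ S := mul_inv_mem_of_isSplit (h.flat S hS.1) (h.flat T hT).1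
    (h.sup_eq_top S hS.1 T hT hS.2) hnd
  have h2 : x = ((1 - n) * b⁻¹ + n * b⁻¹) * (b * x) := by field_simp; ring
  rw [h2]
  -- Of the two parts of `b⁻¹`, one lies in `T`, hence in almost all `S`; the other lies in every
  -- member different from `T`.
  exact S.mul_mem (S.add_mem hS' h1) (hle hbx)

theorem not_isLimit_top_of_not_covers {U : Ultrafilter (Subring K)} {X : Set K} {f : K}
    (hf : f ∈ X) (hf0 : f ≠ 0) (hU : ∀ᶠ S in U, ¬ Covers X S) : ¬ IsLimit U ⊤ := by
  intro h
  obtain ⟨S, h1, h2⟩ := (hU.and (h f⁻¹ trivial)).exists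
  exact h1 (Covers.of_inv_mem hf hf0 h2)

/-! ### Removing split members from a compact family -/

section Successor

variable {Θ₁ : Set (Subring K)}

/-- Otherwise a nonprincipal ultrafilter lives on the exceptional members and has a limit `T ∈ Θ`.
If `T ∈ Θ₁`, a relation expressing `1` over `T` holds over almost all members; if not, `T` is split,
the limit is `K`, and `f` becomes invertible. -/
theorem IsCompactFamily.finite_not_covers (h : IsCompactFamily A Θ)
    (hs : ∀ T ∈ Θ, T ∉ Θ₁ → IsSplit A T) {X : Set K} {f : K} (hf : f ∈ X) (hf0 : f ≠ 0)
    (hX : ∀ T ∈ Θ₁, Covers X T) : {T ∈ Θ | ¬ Covers X T}.Finite := by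
  by_contra hinf
  have := Set.Infinite.cofinite_inf_principal_neBot hinf
  let U := Ultrafilter.of (Filter.cofinite ⊓ Filter.principal {T ∈ Θ | ¬ Covers X T})
  have hle : (U : Filter (Subring K)) ≤ _ := Ultrafilter.of_le _
  have hU : ∀ᶠ S in U, S ∈ Θ ∧ ¬ Covers X S :=
    hle (Filter.mem_inf_of_right (Filter.mem_principal_self _))
  obtain ⟨T, hT, hUT⟩ := h.compact U (hU.mono fun S hS => hS.1)
  have hT₁ : T ∈ Θ₁ := by
    by_contra hT₁
    refine not_isLimit_top_of_not_covers hf hf0 (hU.mono fun S hS => hS.2)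
      (h.isLimit_top_of_isSplit hT (hs T hT hT₁) (U := U) ?_ hUT)
    have hne : ∀ᶠ S in U, S ≠ T :=
      hle (Filter.mem_inf_of_left (Set.finite_singleton T).compl_mem_cofinite)
    exact (hU.and hne).mono fun S hS => ⟨hS.1.1, hS.2⟩
  obtain ⟨S, h1, h2⟩ := (hU.and (hUT.eventually_mem_span (hX T hT₁))).exists
  exact h1.2 h2

theorem IsFlatFamily.exists_mul_inv_mem_sInf (h : IsFlatFamily A Θ) (h₁ : Θ₁ ⊆ Θ)
    {T : Subring K} (hT : T ∈ Θ) (hT₁ : T ∉ Θ₁) (hs : IsSplit A T) {f : K} (hf : f ∈ A)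
    (hf0 : f ≠ 0) : ∃ n ∈ A, (1 - n) * f⁻¹ ∈ T ∧ n * f⁻¹ ∈ sInf Θ₁ := by
  obtain ⟨n, hn, hnT, hnd⟩ := hs f hf hf0
  refine ⟨n, hn, hnT, Subring.mem_sInf.2 fun S hS => ?_⟩
  exact mul_inv_mem_of_isSplit (h.flat S (h₁ hS)) (h.flat T hT).1
    (h.sup_eq_top S (h₁ hS) T hT fun e => hT₁ (e ▸ hS)) hnd

theorem IsFlatFamily.sup_sInf_eq_top (h : IsFlatFamily A Θ) (h₁ : Θ₁ ⊆ Θ)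
    {T : Subring K} (hT : T ∈ Θ) (hT₁ : T ∉ Θ₁) (hs : IsSplit A T) : T ⊔ sInf Θ₁ = ⊤ := by
  rw [eq_top_iff]
  intro x _
  obtain ⟨b, hb, hb0, hbx⟩ := h.frac x
  obtain ⟨n, hn, hnT, hn₁⟩ := h.exists_mul_inv_mem_sInf h₁ hT hT₁ hs hb hb0
  have h2 : x = ((1 - n) * b⁻¹ + n * b⁻¹) * (b * x) := by field_simp; ring
  rw [h2]
  exact Subring.mul_mem _ (Subring.add_mem _ ((le_sup_left : T ≤ _) hnT)
    ((le_sup_right : sInf Θ₁ ≤ T ⊔ sInf Θ₁) hn₁)) ((le_sup_left : T ≤ _) ((h.flat T hT).1 hbx))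

theorem IsFlatFamily.base_le_sInf (h : IsFlatFamily A Θ) (h₁ : Θ₁ ⊆ Θ) : A ≤ sInf Θ₁ :=
  le_sInf fun T hT => (h.flat T (h₁ hT)).1

theorem IsCompactFamily.covers_sInf (h : IsCompactFamily A Θ) (h₁ : Θ₁ ⊆ Θ)
    (hs : ∀ T ∈ Θ, T ∉ Θ₁ → IsSplit A T) {I : Ideal A} (hI : I ≠ ⊥)
    (hX : ∀ T ∈ Θ₁, Covers (Subtype.val '' (I : Set A)) T) :
    Covers (Subtype.val '' (I : Set A)) (sInf Θ₁) := by
  obtain ⟨f, hf, hf0⟩ := (Submodule.ne_bot_iff _).1 hI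
  have hf0' : (f : K) ≠ 0 := fun h => hf0 (Subtype.ext h)
  have hfin := h.finite_not_covers hs (Set.mem_image_of_mem Subtype.val hf) hf0' hX
  -- For finitely many removed `T`, the intersection of the `IT ∩ A` still generates the unit ideal
  -- of `sInf Θ₁`. Taken over all exceptional `T`, this intersection lies in `I` by completeness.
  have key : ∀ E : Finset (Subring K), (E : Set (Subring K)) ⊆ Θ \ Θ₁ →
      Covers {a | a ∈ A ∧ ∀ T ∈ E, a ∈ Submodule.span T (Subtype.val '' (I : Set A) : Set K)}
        (sInf Θ₁) := by
    classical
    intro E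
    induction E using Finset.induction_on with
    | empty => exact fun _ => Covers.of_one_mem ⟨A.one_mem, by simp⟩
    | insert T E _ ih =>
      intro hE
      have hT : T ∈ Θ \ Θ₁ := hE (Finset.mem_insert_self T E)
      have hE' := ih fun S hS => hE (Finset.mem_insert_of_mem hS)
      have hT' : Covers {a | a ∈ A ∧ a ∈ Submodule.span T (Subtype.val '' (I : Set A) : Set K)}
          (sInf Θ₁) := by
        obtain ⟨n, hn, hnT, hn₁⟩ :=
          h.exists_mul_inv_mem_sInf h₁ hT.1 hT.2 (hs T hT.1 hT.2) f.2 hf0'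
        have hfs : (f : K) ∈ Submodule.span T (Subtype.val '' (I : Set A) : Set K) :=
          Submodule.subset_span ⟨f, hf, rfl⟩
        -- Both `1 - n ∈ fT` and `f` lie in `IT`, while the coefficient `n/f` lies in `sInf Θ₁`.
        have e : (1 : K) = (1 - n) + n * (f : K)⁻¹ * f := by field_simp; ring
        rw [Covers, e]
        refine add_mem (Submodule.subset_span ⟨A.sub_mem A.one_mem hn, ?_⟩)
          (mul_mem_span hn₁ (Submodule.subset_span ⟨f.2, hfs⟩))
        have := mul_mem_span hnT hfs
        rwa [mul_assoc, inv_mul_cancel₀ hf0', mul_one] at this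
      refine hT'.mul hE' fun a ha b hb => ⟨A.mul_mem ha.1 hb.1, fun S hS => ?_⟩
      rcases Finset.mem_insert.1 hS with rfl | hS
      · rw [mul_comm]
        exact mul_mem_span ((h.flat S hT.1).1 hb.1) ha.2
      · exact mul_mem_span ((h.flat S (hE (Finset.mem_insert_of_mem hS)).1).1 ha.1) (hb.2 S hS)
  refine (key hfin.toFinset fun T hT => ?_).mono ?_
  · have hT' := hfin.mem_toFinset.1 hT
    exact ⟨hT'.1, fun hT₁ => hT'.2 (hX T hT₁)⟩
  · rintro a ⟨ha, haE⟩
    have : a ∈ Submodule.map (Algebra.linearMap A K) I := by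
      refine h.mem_of_forall_mem_span (X := Submodule.map (Algebra.linearMap A K) I) ?_ ?_
      · exact (Submodule.ne_bot_iff _).2 ⟨f, ⟨f, hf, rfl⟩, hf0'⟩
      · intro T hT
        by_cases hc : Covers (Subtype.val '' (I : Set A)) T
        · have := mul_mem_span ((h.flat T hT).1 ha) hc
          rwa [mul_one] at this
        · exact haE T (hfin.mem_toFinset.2 ⟨hT, hc⟩)
    exact this

theorem IsCompactFamily.flatOver_sInf (h : IsCompactFamily A Θ) (h₁ : Θ₁ ⊆ Θ)
    (hs : ∀ T ∈ Θ, T ∉ Θ₁ → IsSplit A T) : FlatOver A (sInf Θ₁) := by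
  refine ⟨h.base_le_sInf h₁, fun x hx => ?_⟩
  refine (h.covers_sInf h₁ hs (I := elemColon (ringSubmodule (le_refl A)) x) ?_ ?_).mono ?_
  · obtain ⟨b, hb, hb0, hbx⟩ := h.frac x
    exact (Submodule.ne_bot_iff _).2 ⟨⟨b, hb⟩, hbx, fun e => hb0 (congrArg Subtype.val e)⟩
  · intro T hT
    refine ((h.flat T (h₁ hT)).2 x (Subring.mem_sInf.1 hx T hT)).mono ?_
    rintro a ⟨ha, hax⟩
    exact ⟨⟨a, ha⟩, hax, rfl⟩
  · rintro _ ⟨a, ha, rfl⟩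
    exact ⟨a.2, ha⟩

/-- The contraction of a nonzero ideal to a subring with the same quotient field is nonzero. -/
theorem comap_inclusion_ne_bot {A B : Subring K} (hA : ∀ x : K, ∃ b ∈ A, b ≠ 0 ∧ b * x ∈ A)
    (h : A ≤ B) {I : Ideal B} (hI : I ≠ ⊥) : I.comap (Subring.inclusion h) ≠ ⊥ := by
  obtain ⟨x, hx, hx0⟩ := (Submodule.ne_bot_iff _).1 hI
  obtain ⟨b, hb, hb0, hbx⟩ := hA x
  refine (Submodule.ne_bot_iff _).2 ⟨⟨b * x, hbx⟩, ?_, fun e => ?_⟩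
  · exact I.mul_mem_left ⟨b, h hb⟩ hx
  · exact mul_ne_zero hb0 (fun h => hx0 (Subtype.ext h)) (congrArg Subtype.val e)

/-- If `B` is flat over `A` and `I` is an ideal of `B`, then `IT = (I ∩ A)T` for `T ⊇ B`. -/
theorem FlatOver.covers_comap {A B T : Subring K} (h : FlatOver A B) (hT : B ≤ T) {I : Ideal B}
    (hI : Covers (Subtype.val '' (I : Set B)) T) :
    Covers (Subtype.val '' (I.comap (Subring.inclusion h.1) : Set A)) T := by
  refine hI.trans ?_
  rintro _ ⟨x, hx, rfl⟩
  refine ((h.2 x x.2).mono_ring hT).mem_span fun a ha => Submodule.subset_span ?_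
  refine ⟨⟨a * x, ha.2⟩, ?_, mul_comm _ _⟩
  exact I.mul_mem_left ⟨a, h.1 ha.1⟩ hx

theorem covers_iff_one_mem {I : Ideal A} :
    Covers (Subtype.val '' (I : Set A)) A ↔ I = ⊤ := by
  rw [← map_inclusion_eq_top_iff le_rfl]
  have : Subring.inclusion (le_refl A) = RingHom.id A := rfl
  rw [this, Ideal.map_id]

theorem IsCompactFamily.isCompactFamily_sInf (h : IsCompactFamily A Θ) (h₁ : Θ₁ ⊆ Θ)
    (hs : ∀ T ∈ Θ, T ∉ Θ₁ → IsSplit A T) : IsCompactFamily (sInf Θ₁) Θ₁ where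
  frac x := by
    obtain ⟨b, hb, hb0, hbx⟩ := h.frac x
    exact ⟨b, h.base_le_sInf h₁ hb, hb0, h.base_le_sInf h₁ hbx⟩
  flat T hT := (h.flat T (h₁ hT)).of_le (h.base_le_sInf h₁) (sInf_le hT)
  sup_eq_top S hS T hT := h.sup_eq_top S (h₁ hS) T (h₁ hT)
  complete I hI hc := by
    have hf := h.flatOver_sInf h₁ hs
    have := h.covers_sInf h₁ hs (comap_inclusion_ne_bot h.frac hf.1 hI)
      fun T hT => hf.covers_comap (sInf_le hT) (hc T hT)
    refine covers_iff_one_mem.1 (this.mono ?_)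
    rintro _ ⟨a, ha, rfl⟩
    exact ⟨_, ha, rfl⟩
  compact U hU := by
    obtain ⟨T, hT, hUT⟩ := h.compact U (hU.mono fun S hS => h₁ hS)
    by_cases hT₁ : T ∈ Θ₁
    · exact ⟨T, hT₁, hUT⟩
    -- A limit outside `Θ₁` forces the limit `K`, and then any member of `Θ₁` serves.
    · have htop := h.isLimit_top_of_isSplit hT (hs T hT hT₁)
        (hU.mono fun S hS => ⟨h₁ hS, fun e => hT₁ (e ▸ hS)⟩) hUT
      obtain ⟨S, hS⟩ := hU.exists
      exact ⟨S, hS, fun x _ => htop x trivial⟩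

end Successor

end Families

/-! ### From Jaffard and pre-Jaffard families to flat families -/

section Conversion

variable {K : Type u} [Field K] {A : Subring K} {Θ : Set (Subring K)}

theorem exists_mul_mem_of_isFractionRing (A : Subring K) [IsFractionRing A K] (x : K) :
    ∃ b ∈ A, b ≠ 0 ∧ b * x ∈ A := by
  obtain ⟨a, b, hb, rfl⟩ := IsFractionRing.div_surjective (A := A) x
  have hb0 : (b : K) ≠ 0 := fun h => nonZeroDivisors.ne_zero hb (Subtype.ext h)
  refine ⟨b, b.2, hb0, ?_⟩
  change (b : K) * ((a : K) / b) ∈ A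
  rw [mul_div_cancel₀ _ hb0]
  exact a.2

theorem comap_mem_contractions {B T : Subring K} (hA : A ≤ B) (hT : T ≤ B) (hAT : A ≤ T)
    (Q : Ideal B) [hQ : Q.IsPrime] :
    (⟨Q.comap (Subring.inclusion hA), hQ.comap _⟩ : PrimeSpectrum A) ∈ contractions A T := by
  refine ⟨⟨Q.comap (Subring.inclusion hT), hQ.comap _⟩, ?_⟩
  ext x
  constructor
  · rintro ⟨a, ha, rfl⟩
    exact ⟨⟨⟨a, hAT a.2⟩, ha, rfl⟩, a.2⟩
  · rintro ⟨⟨t, ht, rfl⟩, hx⟩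
    exact ⟨⟨t, hx⟩, ht, rfl⟩

/-- If `S ⊔ T` misses `x`, a denominator `b` of `x` is not a unit there. A maximal ideal containing
`b` contracts to a nonzero prime common to `σ(S)` and `σ(T)`. -/
theorem IsIndependent.sup_eq_top (hfrac : ∀ x : K, ∃ b ∈ A, b ≠ 0 ∧ b * x ∈ A)
    (hle : ∀ T ∈ Θ, A ≤ T) (h : IsIndependent A Θ) {S T : Subring K} (hS : S ∈ Θ) (hT : T ∈ Θ)
    (hST : S ≠ T) : S ⊔ T = ⊤ := by
  by_contra hne
  obtain ⟨x, hx⟩ : ∃ x, x ∉ S ⊔ T := by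
    by_contra! H
    exact hne (eq_top_iff.2 fun x _ => H x)
  obtain ⟨b, hb, hb0, hbx⟩ := hfrac x
  have hAB : A ≤ S ⊔ T := (hle S hS).trans le_sup_left
  have hbu : (⟨b, hAB hb⟩ : (S ⊔ T : Subring K)) ∈ nonunits (S ⊔ T : Subring K) := by
    intro hu
    obtain ⟨c, hc⟩ := hu.exists_left_inv
    have hc' : (c : K) * b = 1 := congrArg Subtype.val hc
    apply hx
    have : x = c * (b * x) := by rw [← mul_assoc, hc', one_mul]
    rw [this]
    exact Subring.mul_mem _ c.2 (hAB hbx)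
  obtain ⟨Q, hQ, hbQ⟩ := exists_max_ideal_of_mem_nonunits hbu
  have hP := (h S hS T hT hST ⟨Q.comap (Subring.inclusion hAB), hQ.isPrime.comap _⟩).1
    ⟨comap_mem_contractions hAB le_sup_left (hle S hS) Q,
      comap_mem_contractions hAB le_sup_right (hle T hT) Q⟩
  have hb' : (⟨b, hb⟩ : A) ∈ Q.comap (Subring.inclusion hAB) := hbQ
  have hP' : Q.comap (Subring.inclusion hAB) = ⊥ := hP
  rw [hP'] at hb'
  exact hb0 (congrArg Subtype.val ((Submodule.mem_bot A).1 hb'))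

theorem IsComplete.eq_top_of_covers (h : IsComplete A Θ) (I : Ideal A)
    (hc : ∀ T ∈ Θ, Covers (Subtype.val '' (I : Set A)) T) : I = ⊤ := by
  have h1 : (1 : K) ∈ (Subtype.val '' (I : Set A) : Set K) := by
    rw [h I]
    exact Set.mem_iInter₂.2 hc
  obtain ⟨a, ha, ha1⟩ := h1
  have : a = 1 := Subtype.ext ha1
  exact (Ideal.eq_top_iff_one I).2 (this ▸ ha)

theorem isFlatFamily_of (hfrac : ∀ x : K, ∃ b ∈ A, b ≠ 0 ∧ b * x ∈ A)
    (hf : ∀ T ∈ Θ, IsFlatOverring A T) (hi : IsIndependent A Θ) (hc : IsComplete A Θ) :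
    IsFlatFamily A Θ where
  frac := hfrac
  flat T hT := flatOver_of_isFlatOverring hfrac (hf T hT)
  sup_eq_top _ hS _ hT := hi.sup_eq_top hfrac (fun T hT => (hf T hT).1) hS hT
  complete I _ := hc.eq_top_of_covers I

theorem IsJaffardOverring.isSplit (hfrac : ∀ x : K, ∃ b ∈ A, b ≠ 0 ∧ b * x ∈ A) {T : Subring K}
    (h : IsJaffardOverring A T) : IsSplit A T := by
  obtain ⟨Ψ, hΨ, hT⟩ := h
  exact (isFlatFamily_of hfrac hΨ.flat hΨ.independent hΨ.complete).isSplit hΨ.locallyFinite hT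

theorem IsPreJaffardFamily.isCompactFamily (hfrac : ∀ x : K, ∃ b ∈ A, b ≠ 0 ∧ b * x ∈ A)
    (h : IsPreJaffardFamily A Θ) : IsCompactFamily A Θ where
  toIsFlatFamily := isFlatFamily_of hfrac h.flat h.independent h.complete
  compact U hU := by
    let := zariskiTopology K
    obtain ⟨T, hT, hUT⟩ := isCompact_iff_ultrafilter_le_nhds'.1 h.compact U hU
    refine ⟨T, hT, fun x hx => hUT (IsOpen.mem_nhds ?_ hx)⟩
    refine TopologicalSpace.isOpen_generateFrom_of_mem ⟨{x}, ?_⟩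
    ext S
    simp

end Conversion

/-! ### Compactness along decreasing subfamilies -/

section Limits

variable {K : Type u} [Field K] {A : Subring K} {Θ : Set (Subring K)}

/-- The ring of the elements of `K` that belong to `U`-almost all subrings. -/
def limitRing (U : Ultrafilter (Subring K)) : Subring K where
  carrier := {x | ∀ᶠ S : Subring K in U, x ∈ S}
  mul_mem' hx hy := (hx.and hy).mono fun S hS => S.mul_mem hS.1 hS.2
  add_mem' hx hy := (hx.and hy).mono fun S hS => S.add_mem hS.1 hS.2
  one_mem' := Filter.Eventually.of_forall fun S => S.one_mem
  zero_mem' := Filter.Eventually.of_forall fun S => S.zero_mem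
  neg_mem' hx := hx.mono fun S hS => S.neg_mem hS

theorem IsLimit.sup {U : Ultrafilter (Subring K)} {S T : Subring K} (hS : IsLimit U S)
    (hT : IsLimit U T) : IsLimit U (S ⊔ T) :=
  sup_le (show S ≤ limitRing U from hS) (show T ≤ limitRing U from hT)

/-- Two distinct limits in `Θ` would generate `K`, making `K` a limit; so the limits found in the
various `Ψ i` coincide. -/
theorem IsFlatFamily.exists_isLimit_iInter (h : IsFlatFamily A Θ) {ι : Type*} [Nonempty ι]
    {Ψ : ι → Set (Subring K)} (hΨ : ∀ i, Ψ i ⊆ Θ) {U : Ultrafilter (Subring K)}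
    (hc : ∀ i, ∃ T ∈ Ψ i, IsLimit U T) (hU : ¬ IsLimit U ⊤) :
    ∃ T ∈ ⋂ i, Ψ i, IsLimit U T := by
  choose T hT hUT using hc
  obtain ⟨i₀⟩ := ‹Nonempty ι›
  refine ⟨T i₀, Set.mem_iInter.2 fun i => ?_, hUT i₀⟩
  have : T i = T i₀ := by
    by_contra hne
    apply hU
    rw [← h.sup_eq_top _ (hΨ i (hT i)) _ (hΨ i₀ (hT i₀)) hne]
    exact (hUT i).sup (hUT i₀)
  exact this ▸ hT i

/-- If every `Ψ i` had an exceptional member, some ultrafilter would contain all these exceptional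
sets. Its limit is not `K` because of `f`, so it can be found in the intersection, where `X`
generates the unit ideal. -/
theorem IsFlatFamily.exists_forall_covers (h : IsFlatFamily A Θ) {ι : Type*} [Nonempty ι]
    {Ψ : ι → Set (Subring K)} (hΨ : ∀ i, Ψ i ⊆ Θ) (hd : Directed (· ⊇ ·) Ψ)
    (hc : ∀ i, ∀ U : Ultrafilter (Subring K), (∀ᶠ S in U, S ∈ Ψ i) → ∃ T ∈ Ψ i, IsLimit U T)
    {X : Set K} {f : K} (hf : f ∈ X) (hf0 : f ≠ 0) (hX : ∀ T ∈ ⋂ i, Ψ i, Covers X T) :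
    ∃ i, ∀ T ∈ Ψ i, Covers X T := by
  by_contra! H
  have hne : (⨅ i, Filter.principal (Ψ i ∩ {T | ¬ Covers X T})).NeBot := by
    refine Filter.iInf_neBot_of_directed' ?_ fun i => ?_
    · intro i j
      obtain ⟨k, hik, hjk⟩ := hd i j
      exact ⟨k, Filter.principal_mono.2 (Set.inter_subset_inter_left _ hik),
        Filter.principal_mono.2 (Set.inter_subset_inter_left _ hjk)⟩
    · obtain ⟨T, hT, hT'⟩ := H i
      exact Filter.principal_neBot_iff.2 ⟨T, hT, hT'⟩
  let U := Ultrafilter.of (⨅ i, Filter.principal (Ψ i ∩ {T | ¬ Covers X T}))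
  have hle : (U : Filter (Subring K)) ≤ _ := Ultrafilter.of_le _
  have hU : ∀ i, ∀ᶠ S in U, S ∈ Ψ i ∧ ¬ Covers X S := fun i =>
    hle (Filter.mem_iInf_of_mem i (Filter.mem_principal_self _))
  obtain ⟨i₀⟩ := ‹Nonempty ι›
  have hU₀ : ∀ᶠ S in U, ¬ Covers X S := (hU i₀).mono fun S hS => hS.2
  have : Nonempty ι := ⟨i₀⟩
  obtain ⟨T, hT, hUT⟩ := h.exists_isLimit_iInter hΨ
    (fun i => hc i U ((hU i).mono fun S hS => hS.1)) (not_isLimit_top_of_not_covers hf hf0 hU₀)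
  obtain ⟨S, h1, h2⟩ := (hU₀.and (hUT.eventually_mem_span (hX T hT))).exists
  exact h1 h2

theorem IsFlatFamily.covers_of_forall_covers {D : Subring K} (h : IsFlatFamily A Θ) (hD : D ≤ A)
    {I : Ideal D} (hI : I ≠ ⊥) (hc : ∀ T ∈ Θ, Covers (Subtype.val '' (I : Set D)) T) :
    Covers (Subtype.val '' (I : Set D)) A := by
  rw [← map_inclusion_eq_top_iff hD]
  apply h.complete
  · obtain ⟨f, hf, hf0⟩ := (Submodule.ne_bot_iff _).1 hI
    refine (Submodule.ne_bot_iff _).2 ⟨_, Ideal.mem_map_of_mem _ hf, fun e => hf0 ?_⟩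
    exact Subtype.ext (congrArg (Subtype.val : A → K) e)
  · intro T hT
    refine (hc T hT).mono ?_
    rintro _ ⟨a, ha, rfl⟩
    exact ⟨_, Ideal.mem_map_of_mem (Subring.inclusion hD) ha, rfl⟩

end Limits

/-! ### Gabriel filters and the ideals `IT ∩ D` -/

section Saturation

variable {K : Type u} [Field K] {D : Subring K}

theorem saturation_mono {I J : Ideal D} (h : I ≤ J) {T : Subring K} (hT : D ≤ T) :
    saturation I T hT ≤ saturation J T hT :=
  Ideal.comap_mono (Ideal.map_mono h)

theorem le_saturation (I : Ideal D) {T : Subring K} (hT : D ≤ T) : I ≤ saturation I T hT :=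
  Ideal.le_comap_map

theorem covers_elemColon {B : Subring K} (hB : FlatOver D B) {I : Ideal D} {y : D}
    (hy : y ∈ saturation I B hB.1) : Covers (Subtype.val '' (elemColon I y : Set D)) B := by
  rw [mem_saturation_iff] at hy
  refine (hB.covers_colon (Submodule.map (Algebra.linearMap D K) I) hy).mono ?_
  rintro a ⟨ha, b, hb, hab⟩
  refine ⟨⟨a, ha⟩, ?_, rfl⟩
  have : b = (⟨a, ha⟩ : D) • y := Subtype.ext hab
  rw [SetLike.mem_coe, mem_elemColon, ← this]
  exact hb

/-- For `y ∈ IB ∩ D` the ideal `(I : y)` generates `B` and contains `I`, so `hc` puts it in `F`; the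
Gabriel axiom concludes. -/
theorem mem_of_saturation_mem (F : GabrielFilter D) {B : Subring K} (hB : FlatOver D B)
    {Ψ : Set (Subring K)}
    (hc : ∀ I : Ideal D, Covers (Subtype.val '' (I : Set D)) B →
      (∀ T (hT : D ≤ T), T ∈ Ψ → saturation I T hT ∈ F) → I ∈ F)
    {I : Ideal D} (hI : saturation I B hB.1 ∈ F)
    (hΨ : ∀ T (hT : D ≤ T), T ∈ Ψ → saturation I T hT ∈ F) : I ∈ F :=
  F.mem_of_forall_elemColon hI fun y hy => hc _ (covers_elemColon hB hy) fun T hT hTΨ =>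
    F.mono (hΨ T hT hTΨ) (saturation_mono (le_elemColon I y) hT)

end Saturation

/-! ### Transfinite induction along the derived sequence -/

section Derived

variable {K : Type u} [Field K] (D : Subring K) (Θ : Set (Subring K))

theorem derivedFamily_zero : derivedFamily D Θ (0 : Ordinal.{v}) = Θ := by
  simp [derivedFamily, derivedPair]

theorem derivedRing_zero : derivedRing D Θ (0 : Ordinal.{v}) = D := by
  simp [derivedRing, derivedPair]

theorem derivedFamily_add_one (α : Ordinal.{v}) : derivedFamily D Θ (α + 1) =
    derivedFamily D Θ α \ {T | IsJaffardOverring (derivedRing D Θ α) T} := by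
  simp only [derivedFamily, derivedRing, derivedPair, Ordinal.limitRecOn_add_one]

theorem derivedRing_add_one (α : Ordinal.{v}) :
    derivedRing D Θ (α + 1) = sInf (derivedFamily D Θ (α + 1)) := by
  simp only [derivedFamily, derivedRing, derivedPair, Ordinal.limitRecOn_add_one]

theorem derivedFamily_limit {α : Ordinal.{v}} (hα : Order.IsSuccLimit α) :
    derivedFamily D Θ α = ⋂ β : Set.Iio α, derivedFamily D Θ β.1 := by
  unfold derivedFamily
  rw [derivedPair, Ordinal.limitRecOn_limit _ _ _ _ hα]
  ext T
  simp only [Set.mem_iInter, Subtype.forall, Set.mem_Iio]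
  rfl

theorem derivedRing_limit {α : Ordinal.{v}} (hα : Order.IsSuccLimit α) :
    derivedRing D Θ α = sInf (derivedFamily D Θ α) := by
  unfold derivedFamily derivedRing
  rw [derivedPair, Ordinal.limitRecOn_limit _ _ _ _ hα]

theorem derivedFamily_antitone : Antitone (derivedFamily D Θ : Ordinal.{v} → _) := by
  intro β α h
  induction α using Ordinal.limitRecOn with
  | zero =>
    have : β = 0 := le_antisymm h zero_le
    rw [this]
  | add_one γ ih =>
    rcases h.lt_or_eq with h | rfl
    · rw [derivedFamily_add_one]
      exact Set.sdiff_subset.trans (ih (Order.lt_add_one_iff.1 h))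
    · exact le_rfl
  | limit γ hγ ih =>
    rcases h.lt_or_eq with h | rfl
    · rw [derivedFamily_limit D Θ hγ]
      exact Set.iInter_subset_of_subset ⟨β, h⟩ le_rfl
    · exact le_rfl

/-- What the transfinite induction along the derived sequence carries. -/
structure IsDerivedStage (B : Subring K) (Ψ : Set (Subring K)) : Prop where
  family : IsCompactFamily B Ψ
  flat : FlatOver D B
  sup_eq_top : ∀ T ∈ Θ, T ∉ Ψ → T ⊔ B = ⊤
  mem_of_covers : ∀ (F : GabrielFilter D) (I : Ideal D),
    Covers (Subtype.val '' (I : Set D)) B →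
      (∀ T (hT : D ≤ T), T ∈ Θ \ Ψ → saturation I T hT ∈ F) → I ∈ F

variable {D Θ}

theorem IsCompactFamily.isDerivedStage_zero (h : IsCompactFamily D Θ) :
    IsDerivedStage D Θ D Θ where
  family := h
  flat := FlatOver.refl D
  sup_eq_top T hT hT' := absurd hT hT'
  mem_of_covers F I hI _ := by
    rw [covers_iff_one_mem.1 hI]
    exact F.top_mem

theorem IsDerivedStage.succ (h : IsCompactFamily D Θ) {B : Subring K} {Ψ Ψ₁ : Set (Subring K)}
    (hΨ : Ψ ⊆ Θ) (hB : IsDerivedStage D Θ B Ψ) (h₁ : Ψ₁ ⊆ Ψ)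
    (hs : ∀ T ∈ Ψ, T ∉ Ψ₁ → IsSplit B T) : IsDerivedStage D Θ (sInf Ψ₁) Ψ₁ where
  family := hB.family.isCompactFamily_sInf h₁ hs
  flat := hB.flat.trans (hB.family.flatOver_sInf h₁ hs)
  sup_eq_top T hT hT₁ := by
    by_cases hTΨ : T ∈ Ψ
    · exact hB.family.sup_sInf_eq_top h₁ hTΨ hT₁ (hs T hTΨ hT₁)
    · rw [eq_top_iff, ← hB.sup_eq_top T hT hTΨ]
      exact sup_le_sup_left (hB.family.base_le_sInf h₁) T
  mem_of_covers F I hI hF := by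
    obtain ⟨_, ⟨f, hf, rfl⟩, hf0⟩ := hI.exists_ne_zero
    have hle : ∀ T ∈ Ψ, D ≤ T := fun T hT => (h.flat T (hΨ hT)).1
    have hcov : ∀ T ∈ Ψ₁, Covers (Subtype.val '' (I : Set D)) T :=
      fun T hT => hI.mono_ring (sInf_le hT)
    have hfin := hB.family.finite_not_covers hs (Set.mem_image_of_mem Subtype.val hf) hf0 hcov
    -- Only finitely many `T ∈ Ψ` have `IT ≠ T`, and all of them are removed. The intersection of
    -- their `IT ∩ D` is in `F` and, by completeness over `B`, lies in `IB ∩ D`.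
    refine mem_of_saturation_mem F hB.flat (hB.mem_of_covers F) (F.mono
      (F.finset_inf_mem hfin.toFinset.attach (fun T => saturation I T.1
        (hle T.1 (hfin.mem_toFinset.1 T.2).1)) fun T _ => ?_) ?_) ?_
    · have hT := hfin.mem_toFinset.1 T.2
      exact hF _ _ ⟨hΨ hT.1, fun hT₁ => hT.2 (hcov _ hT₁)⟩
    · intro y hy
      rw [mem_saturation_iff]
      refine hB.family.mem_of_forall_mem_span
        (X := Submodule.span B (Subtype.val '' (I : Set D) : Set K)) ?_ fun T hT => ?_
      · exact (Submodule.ne_bot_iff _).2 ⟨f, Submodule.subset_span ⟨f, hf, rfl⟩, hf0⟩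
      · refine Submodule.span_mono (R := T) Submodule.subset_span ?_
        by_cases hc : Covers (Subtype.val '' (I : Set D)) T
        · have := mul_mem_span (hle T hT y.2) hc
          rwa [mul_one] at this
        · rw [← mem_saturation_iff (hle T hT)]
          exact Finset.inf_le (f := fun T : hfin.toFinset => saturation I T.1
            (hle T.1 (hfin.mem_toFinset.1 T.2).1)) (b := ⟨T, hfin.mem_toFinset.2 ⟨hT, hc⟩⟩)
            (Finset.mem_attach _ _) hy
    · exact fun T hT hTΨ => hF T hT ⟨hTΨ.1, fun hT₁ => hTΨ.2 (h₁ hT₁)⟩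

theorem IsDerivedStage.limit (h : IsCompactFamily D Θ) {ι : Type*} [Nonempty ι]
    {B : ι → Subring K} {Ψ : ι → Set (Subring K)} (hΨ : ∀ i, Ψ i ⊆ Θ) (hd : Directed (· ⊇ ·) Ψ)
    (hB : ∀ i, IsDerivedStage D Θ (B i) (Ψ i)) :
    IsDerivedStage D Θ (sInf (⋂ i, Ψ i)) (⋂ i, Ψ i) := by
  obtain ⟨i₀⟩ := ‹Nonempty ι›
  have : Nonempty ι := ⟨i₀⟩
  have hsub : ⋂ i, Ψ i ⊆ Θ := (Set.iInter_subset Ψ i₀).trans (hΨ i₀)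
  have hDle : D ≤ sInf (⋂ i, Ψ i) := h.base_le_sInf hsub
  have hBle : ∀ i, B i ≤ sInf (⋂ i, Ψ i) := fun i =>
    le_sInf fun T hT => ((hB i).family.flat T (Set.mem_iInter.1 hT i)).1
  -- Triviality over the intersection is reached at some stage `i`; flatness, completeness and
  -- membership in `F` are then inherited from that stage.
  have key : ∀ I : Ideal D, I ≠ ⊥ → (∀ T ∈ ⋂ i, Ψ i, Covers (Subtype.val '' (I : Set D)) T) →
      ∃ i, Covers (Subtype.val '' (I : Set D)) (B i) := by
    intro I hI hc
    obtain ⟨f, hf, hf0⟩ := (Submodule.ne_bot_iff _).1 hI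
    obtain ⟨i, hi⟩ := h.exists_forall_covers hΨ hd (fun i => (hB i).family.compact)
      (Set.mem_image_of_mem Subtype.val hf) (fun e => hf0 (Subtype.ext e)) hc
    exact ⟨i, (hB i).family.covers_of_forall_covers (hB i).flat.1 hI hi⟩
  have hflat : FlatOver D (sInf (⋂ i, Ψ i)) := by
    refine ⟨hDle, fun x hx => ?_⟩
    obtain ⟨i, hi⟩ := key (elemColon (ringSubmodule (le_refl D)) x) (by
      obtain ⟨b, hb, hb0, hbx⟩ := h.frac x
      exact (Submodule.ne_bot_iff _).2 ⟨⟨b, hb⟩, hbx, fun e => hb0 (congrArg Subtype.val e)⟩) (by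
      intro T hT
      refine ((h.flat T (hsub hT)).2 x (Subring.mem_sInf.1 hx T hT)).mono ?_
      rintro a ⟨ha, hax⟩
      exact ⟨⟨a, ha⟩, hax, rfl⟩)
    refine (hi.mono_ring (hBle i)).mono ?_
    rintro _ ⟨a, ha, rfl⟩
    exact ⟨a.2, ha⟩
  refine ⟨⟨⟨fun x => ?_, fun T hT => ?_, fun S hS T hT => ?_, fun I hI hc => ?_⟩, fun U hU => ?_⟩,
    hflat, fun T hT hT' => ?_, fun F I hI hF => ?_⟩
  · obtain ⟨b, hb, hb0, hbx⟩ := h.frac x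
    exact ⟨b, hDle hb, hb0, hDle hbx⟩
  · exact (h.flat T (hsub hT)).of_le hDle (sInf_le hT)
  · exact h.sup_eq_top S (hsub hS) T (hsub hT)
  · obtain ⟨i, hi⟩ := key _ (comap_inclusion_ne_bot h.frac hflat.1 hI) fun T hT =>
      hflat.covers_comap (sInf_le hT) (hc T hT)
    refine covers_iff_one_mem.1 ((hi.mono_ring (hBle i)).mono ?_)
    rintro _ ⟨a, ha, rfl⟩
    exact ⟨_, ha, rfl⟩
  · by_cases htop : IsLimit U ⊤
    · obtain ⟨S, hS⟩ := hU.exists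
      exact ⟨S, hS, fun x _ => htop x trivial⟩
    · exact h.exists_isLimit_iInter hΨ (fun i => (hB i).family.compact U
        (hU.mono fun S hS => Set.mem_iInter.1 hS i)) htop
  · obtain ⟨i, hi⟩ : ∃ i, T ∉ Ψ i := by simpa using hT'
    rw [eq_top_iff, ← (hB i).sup_eq_top T hT hi]
    exact sup_le_sup_left (hBle i) T
  · obtain ⟨_, ⟨f, hf, rfl⟩, hf0⟩ := hI.exists_ne_zero
    obtain ⟨i, hi⟩ := key I ((Submodule.ne_bot_iff _).2
      ⟨f, hf, fun e => hf0 (congrArg Subtype.val e)⟩) fun T hT => hI.mono_ring (sInf_le hT)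
    exact (hB i).mem_of_covers F I hi fun T hT hTΨ =>
      hF T hT ⟨hTΨ.1, fun hT' => hTΨ.2 (Set.mem_iInter.1 hT' i)⟩

theorem IsCompactFamily.isDerivedStage (h : IsCompactFamily D Θ) (α : Ordinal.{v}) :
    IsDerivedStage D Θ (derivedRing D Θ α) (derivedFamily D Θ α) := by
  have hsub : ∀ β : Ordinal.{v}, derivedFamily D Θ β ⊆ Θ := fun β => by
    have := derivedFamily_antitone D Θ (zero_le : 0 ≤ β)
    rwa [derivedFamily_zero] at this
  induction α using Ordinal.limitRecOn with
  | zero =>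
    rw [derivedFamily_zero, derivedRing_zero]
    exact h.isDerivedStage_zero
  | add_one γ ih =>
    rw [derivedRing_add_one, derivedFamily_add_one]
    refine ih.succ h (hsub γ) Set.sdiff_subset fun T hT hT' => ?_
    have hJ : IsJaffardOverring (derivedRing D Θ γ) T := by
      by_contra hJ
      exact hT' ⟨hT, hJ⟩
    exact hJ.isSplit ih.family.frac
  | limit γ hγ ih =>
    rw [derivedRing_limit D Θ hγ, derivedFamily_limit D Θ hγ]
    have : Nonempty (Set.Iio γ) := ⟨⟨0, hγ.bot_lt⟩⟩
    refine IsDerivedStage.limit h (B := fun β : Set.Iio γ => derivedRing D Θ β.1)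
      (fun β => hsub β.1) ?_ fun β => ih β.1 β.2
    intro β β'
    rcases le_total β β' with hle | hle
    · exact ⟨β', derivedFamily_antitone D Θ hle, le_rfl⟩
    · exact ⟨β, le_rfl, derivedFamily_antitone D Θ hle⟩

theorem IsCompactFamily.flatOver_of_mem_truncation (h : IsCompactFamily D Θ) {α : Ordinal.{v}}
    {T : Subring K} (hT : T ∈ truncation D Θ α) : FlatOver D T := by
  rcases hT with hT | rfl
  · exact h.flat T hT.1
  · exact (h.isDerivedStage α).flat

theorem IsCompactFamily.sup_eq_top_of_mem_truncation (h : IsCompactFamily D Θ) {α : Ordinal.{v}}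
    {S T : Subring K} (hS : S ∈ truncation D Θ α) (hT : T ∈ truncation D Θ α) (hST : S ≠ T) :
    S ⊔ T = ⊤ := by
  rcases hS with hS | rfl <;> rcases hT with hT | rfl
  · exact h.sup_eq_top S hS.1 T hT.1 hST
  · exact (h.isDerivedStage α).sup_eq_top S hS.1 hS.2
  · rw [sup_comm]
    exact (h.isDerivedStage α).sup_eq_top T hT.1 hT.2
  · exact absurd rfl hST

theorem IsCompactFamily.mem_of_saturation_mem (h : IsCompactFamily D Θ) (α : Ordinal.{v})
    (F : GabrielFilter D) (I : Ideal D)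
    (hI : ∀ T (hT : D ≤ T), T ∈ truncation D Θ α → saturation I T hT ∈ F) : I ∈ F :=
  PreJaffard.mem_of_saturation_mem F (h.isDerivedStage α).flat
    ((h.isDerivedStage α).mem_of_covers F) (hI _ _ (Or.inr rfl)) fun T hT hTΘ =>
      hI T hT (Or.inl hTΘ)

end Derived

/-! ### Gabriel filters of `D` and of the truncation -/

section ChangeOfRings

namespace GabrielFilter

/-- The ideals of `S` whose contraction belongs to `F`. -/
def comapInv {R S : Type*} [CommRing R] [CommRing S] (F : GabrielFilter R) (φ : R →+* S)
    (hφ : Function.Injective φ) : GabrielFilter S where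
  sets := {J | J.comap φ ∈ F}
  top_mem' := by
    change Ideal.comap φ ⊤ ∈ F
    rw [Ideal.comap_top]
    exact F.top_mem
  mono' I J hI h := F.mono hI (Ideal.comap_mono h)
  gabriel' J hJ I h := F.mem_of_forall_elemColon hJ fun y hy => F.mono (h (φ y) hy) fun a ha => by
    rw [Ideal.mem_comap, mem_elemColon, smul_eq_mul, ← map_mul] at ha
    exact ha
  bot_notMem' h := F.bot_notMem (by
    have h' : Ideal.comap φ ⊥ ∈ F := h
    rwa [← RingHom.ker_eq_comap_bot, (RingHom.injective_iff_ker_eq_bot φ).1 hφ] at h')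

/-- The ideals of `R` whose extension to each `S i` belongs to `G i`. -/
def mapInv {R : Type*} [CommRing R] {ι : Type*} [Nonempty ι] {S : ι → Type*}
    [∀ i, CommRing (S i)] (φ : ∀ i, R →+* S i) (G : ∀ i, GabrielFilter (S i)) :
    GabrielFilter R where
  sets := {I | ∀ i, I.map (φ i) ∈ G i}
  top_mem' i := by
    rw [Ideal.map_top]
    exact (G i).top_mem
  mono' I J hI h i := (G i).mono (hI i) (Ideal.map_mono h)
  gabriel' J hJ I h i := by
    refine (G i).mem_of_forall_elemColon (hJ i) fun z hz => ?_
    induction hz using Submodule.span_induction with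
    | mem x hx =>
      obtain ⟨y, hy, rfl⟩ := hx
      refine (G i).mono (h y hy i) (Ideal.map_le_iff_le_comap.2 fun a ha => ?_)
      rw [Ideal.mem_comap, mem_elemColon, smul_eq_mul, ← map_mul]
      exact Ideal.mem_map_of_mem _ ha
    | zero =>
      refine (G i).mono (G i).top_mem fun a _ => ?_
      rw [mem_elemColon, smul_zero]
      exact zero_mem _
    | add x y _ _ hx hy =>
      refine (G i).mono ((G i).inf_mem hx hy) fun a ha => ?_
      rw [mem_elemColon, smul_add]
      exact add_mem ha.1 ha.2
    | smul t x _ hx =>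
      refine (G i).mono hx fun a ha => ?_
      rw [mem_elemColon, smul_comm]
      exact Submodule.smul_mem _ t ha
  bot_notMem' h := by
    obtain ⟨i⟩ := ‹Nonempty ι›
    have := h i
    rw [Ideal.map_bot] at this
    exact (G i).bot_notMem this

end GabrielFilter

variable {K : Type u} [Field K] {D : Subring K} {Θ : Set (Subring K)}

theorem FlatOver.map_comap_inclusion {A T : Subring K} (h : FlatOver A T) (J : Ideal T) :
    (J.comap (Subring.inclusion h.1)).map (Subring.inclusion h.1) = J := by
  refine le_antisymm Ideal.map_comap_le fun x hx => ?_
  rw [mem_map_inclusion_iff]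
  refine (h.2 x x.2).mem_span fun a ha => Submodule.subset_span ⟨⟨a * x, ha.2⟩, ?_, mul_comm _ _⟩
  exact J.mul_mem_left ⟨a, h.1 ha.1⟩ hx

/-- For `0 ≠ x ∈ J`, any `a ∈ A` with `a/x ∈ T` lies in `J`, and such `a` generate `S` by
orthogonality. -/
theorem FlatOver.map_comap_inclusion_eq_top {A S T : Subring K} (hS : FlatOver A S) (hT : A ≤ T)
    (hST : S ⊔ T = ⊤) {J : Ideal T} (hJ : J ≠ ⊥) :
    (J.comap (Subring.inclusion hT)).map (Subring.inclusion hS.1) = ⊤ := by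
  rw [map_inclusion_eq_top_iff]
  obtain ⟨x, hx, hx0⟩ := (Submodule.ne_bot_iff _).1 hJ
  have hx0' : (x : K) ≠ 0 := fun h => hx0 (Subtype.ext h)
  refine (hS.covers_of_sup_eq_top hT hST (x : K)⁻¹).mono ?_
  rintro a ⟨ha, hax⟩
  refine ⟨⟨a, ha⟩, ?_, rfl⟩
  have : Subring.inclusion hT ⟨a, ha⟩ = ⟨a * (x : K)⁻¹, hax⟩ * x := by
    apply Subtype.ext
    change a = a * (x : K)⁻¹ * x
    rw [mul_assoc, inv_mul_cancel₀ hx0', mul_one]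
  rw [SetLike.mem_coe, Ideal.mem_comap, this]
  exact J.mul_mem_left _ hx

instance (α : Ordinal.{v}) : Nonempty (truncation D Θ α) :=
  ⟨⟨derivedRing D Θ α, Or.inr rfl⟩⟩

/-- Gabriel filters of `D` correspond to families of Gabriel filters of the rings in the
truncation. -/
def gabrielIso (hΘ : IsPreJaffardFamily D Θ) (h : IsCompactFamily D Θ) (α : Ordinal.{v}) :
    GabrielFilter D ≃o ((T : truncation D Θ α) → GabrielFilter T.1) where
  toFun F T := F.comapInv (Subring.inclusion (hΘ.le_of_mem_truncation T.2))
    (Subring.inclusion_injective _)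
  invFun G := GabrielFilter.mapInv
    (fun T => Subring.inclusion (hΘ.le_of_mem_truncation T.2)) G
  left_inv F := by
    apply GabrielFilter.ext
    ext I
    constructor
    · exact fun hI => h.mem_of_saturation_mem α F I fun T hT hT' => hI ⟨T, hT'⟩
    · exact fun hI T => F.mono hI Ideal.le_comap_map
  right_inv G := by
    funext T
    have hTf := h.flatOver_of_mem_truncation T.2
    apply GabrielFilter.ext
    ext J
    constructor
    · intro hJ
      have := hJ T
      rwa [hTf.map_comap_inclusion] at this
    · intro hJ S
      by_cases hST : S = T
      · subst hST
        rwa [hTf.map_comap_inclusion]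
      · have hne : J ≠ ⊥ := by
          rintro rfl
          exact (G T).bot_notMem hJ
        rw [(h.flatOver_of_mem_truncation S.2).map_comap_inclusion_eq_top hTf.1
          (h.sup_eq_top_of_mem_truncation S.2 T.2 fun e => hST (Subtype.ext e)) hne]
        exact (G S).top_mem
  map_rel_iff' := by
    intro F G
    constructor
    · intro hle I hI
      refine h.mem_of_saturation_mem α G I fun T hT hT' => hle ⟨T, hT'⟩ ?_
      exact F.mono hI (le_saturation I hT)
    · exact fun hle T J hJ => hle hJ

end ChangeOfRings

/-! ### Stable semistar operations as Gabriel filters -/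

section Semistar

variable {K : Type u} [Field K] {A : Subring K}

/-- An ideal of `A`, as a submodule of `K`. -/
def idealSubmodule (I : Ideal A) : Submodule A K :=
  Submodule.map (Algebra.linearMap A K) I

theorem mem_idealSubmodule {I : Ideal A} {a : A} : (a : K) ∈ idealSubmodule I ↔ a ∈ I := by
  constructor
  · rintro ⟨b, hb, hab⟩
    have : b = a := Subtype.ext hab
    exact this ▸ hb
  · exact fun h => ⟨a, h, rfl⟩

theorem elemColon_idealSubmodule (I : Ideal A) (y : A) :
    elemColon (idealSubmodule I) (y : K) = elemColon I y := by
  ext a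
  exact mem_idealSubmodule (a := a * y)

theorem mem_smul_submodule_iff {X : Submodule A K} {c x : K} (hc : c ≠ 0) :
    x ∈ c • X ↔ c⁻¹ * x ∈ X := by
  rw [Submodule.mem_smul_pointwise_iff_exists]
  constructor
  · rintro ⟨y, hy, rfl⟩
    rwa [smul_eq_mul, inv_mul_cancel_left₀ hc]
  · exact fun h => ⟨_, h, by rw [smul_eq_mul, mul_inv_cancel_left₀ hc]⟩

theorem zero_smul_submodule (X : Submodule A K) : (0 : K) • X = ⊥ := by
  rw [eq_bot_iff]
  intro x hx
  rw [Submodule.mem_smul_pointwise_iff_exists] at hx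
  obtain ⟨y, _, rfl⟩ := hx
  simp

namespace StableSemistar

theorem le_apply (s : StableSemistar A) (X : Submodule A K) : X ≤ s X := s.le_toFun' X

/-- Homogeneity at `x = 0` is what keeps the zero ideal out of the associated filter. -/
theorem apply_bot (s : StableSemistar A) : s ⊥ = ⊥ := by
  have := s.smul' 0 ⊥
  rwa [zero_smul_submodule, zero_smul_submodule, eq_comm] at this

/-- For `x ≠ 0` the colon `(X : x)` is `x⁻¹X ∩ A`; stability and homogeneity carry the closure
through. -/
theorem mem_apply_iff (s : StableSemistar A) (X : Submodule A K) (x : K) :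
    x ∈ s X ↔ (1 : K) ∈ s (idealSubmodule (elemColon X x)) := by
  have h1 : (1 : K) ∈ s (idealSubmodule (⊤ : Ideal A)) :=
    s.le_apply _ (mem_idealSubmodule (a := 1) |>.2 trivial)
  by_cases hx : x = 0
  · have : elemColon X x = ⊤ := by
      rw [Ideal.eq_top_iff_one, mem_elemColon, hx, smul_zero]
      exact X.zero_mem
    rw [this, hx]
    exact ⟨fun _ => h1, fun _ => zero_mem _⟩
  · have hx' : x⁻¹ ≠ 0 := inv_ne_zero hx
    have : idealSubmodule (elemColon X x) = x⁻¹ • X ⊓ idealSubmodule (⊤ : Ideal A) := by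
      ext y
      rw [Submodule.mem_inf, mem_smul_submodule_iff hx', inv_inv]
      constructor
      · rintro ⟨a, ha, rfl⟩
        refine ⟨?_, mem_idealSubmodule.2 trivial⟩
        rw [mul_comm]
        exact ha
      · rintro ⟨hy, a, _, rfl⟩
        refine mem_idealSubmodule.2 ?_
        rw [mul_comm] at hy
        exact hy
    rw [this, s.inf', ← s.smul', Submodule.mem_inf, mem_smul_submodule_iff hx', inv_inv, mul_one]
    exact ⟨fun h => ⟨h, h1⟩, fun h => h.1⟩

/-- The Gabriel filter of the ideals whose closure contains `1`. -/
def gabriel (s : StableSemistar A) : GabrielFilter A where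
  sets := {I | (1 : K) ∈ s (idealSubmodule I)}
  top_mem' := s.le_apply _ (mem_idealSubmodule (a := 1) |>.2 trivial)
  mono' I J hI h := s.mono' _ _ (Submodule.map_mono h) hI
  gabriel' J hJ I h := by
    have hle : idealSubmodule J ≤ s (idealSubmodule I) := by
      rintro _ ⟨y, hy, rfl⟩
      change (y : K) ∈ s (idealSubmodule I)
      rw [s.mem_apply_iff, elemColon_idealSubmodule]
      exact h y hy
    have := s.mono' _ _ hle hJ
    rwa [s.idem'] at this
  bot_notMem' h := by
    have h' : (1 : K) ∈ s (idealSubmodule (⊥ : Ideal A)) := h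
    rw [idealSubmodule, Submodule.map_bot, s.apply_bot] at h'
    exact one_ne_zero ((Submodule.mem_bot A).1 h')

theorem mem_apply_iff_gabriel (s : StableSemistar A) (X : Submodule A K) (x : K) :
    x ∈ s X ↔ elemColon X x ∈ s.gabriel :=
  s.mem_apply_iff X x

end StableSemistar

/-- The closure of `X` consists of the `x` for which `(X : x)` belongs to `F`. -/
def GabrielFilter.closure (F : GabrielFilter A) (X : Submodule A K) : Submodule A K where
  carrier := {x | elemColon X x ∈ F}
  add_mem' hx hy := F.mono (F.inf_mem hx hy) fun a ha => by
    rw [mem_elemColon, smul_add]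
    exact X.add_mem ha.1 ha.2
  zero_mem' := F.mono F.top_mem fun a _ => by
    rw [mem_elemColon, smul_zero]
    exact X.zero_mem
  smul_mem' c x hx := F.mono hx fun a ha => by
    rw [mem_elemColon, smul_comm]
    exact X.smul_mem c ha

theorem GabrielFilter.mem_closure {F : GabrielFilter A} {X : Submodule A K} {x : K} :
    x ∈ F.closure X ↔ elemColon X x ∈ F := Iff.rfl

/-- The stable semistar operation of a Gabriel filter. -/
def GabrielFilter.semistar (F : GabrielFilter A) : StableSemistar A where
  toFun := F.closure
  le_toFun' X x hx := F.mono F.top_mem fun a _ => X.smul_mem a hx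
  mono' X Y h x hx := F.mono hx fun a ha => h ha
  idem' X := by
    refine le_antisymm (fun x hx => F.mem_of_forall_elemColon hx fun y hy => ?_) fun x hx =>
      F.mono F.top_mem fun a _ => Submodule.smul_mem _ a hx
    refine F.mono (show elemColon X (y • x) ∈ F from hy) fun a ha => ?_
    rw [mem_elemColon, mem_elemColon, smul_eq_mul, mul_smul]
    exact ha
  smul' c X := by
    by_cases hc : c = 0
    · rw [hc, zero_smul_submodule, zero_smul_submodule, eq_comm, eq_bot_iff]
      intro x hx
      by_contra hx0
      refine F.bot_notMem (F.mono (show elemColon ⊥ x ∈ F from hx) fun a ha => ?_)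
      rw [mem_elemColon, Submodule.mem_bot, Subring.smul_def, smul_eq_mul] at ha
      exact Subtype.ext ((mul_eq_zero.1 ha).resolve_right hx0)
    · ext x
      rw [mem_smul_submodule_iff hc, GabrielFilter.mem_closure, GabrielFilter.mem_closure]
      have : elemColon (c • X) x = elemColon X (c⁻¹ * x) := by
        ext a
        rw [mem_elemColon, mem_elemColon, mem_smul_submodule_iff hc, mul_smul_comm]
      rw [this]
  inf' X Y := by
    ext x
    exact ⟨fun hx => ⟨F.mono hx fun a ha => ha.1, F.mono hx fun a ha => ha.2⟩,
      fun hx => F.mono (F.inf_mem hx.1 hx.2) fun a ha => ha⟩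

variable (A) in
/-- Stable semistar operations correspond to Gabriel filters. -/
def semistarIso : StableSemistar A ≃o GabrielFilter A where
  toFun s := s.gabriel
  invFun F := F.semistar
  left_inv s := by
    apply StableSemistar.ext
    funext X
    ext x
    exact (s.mem_apply_iff X x).symm
  right_inv F := by
    apply GabrielFilter.ext
    ext I
    change elemColon (idealSubmodule I) (1 : K) ∈ F ↔ I ∈ F
    have : elemColon (idealSubmodule I) (1 : K) = I := by
      ext a
      rw [← mem_idealSubmodule (I := I), mem_elemColon, Subring.smul_def, smul_eq_mul, mul_one]
    rw [this]
  map_rel_iff' := by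
    intro s t
    constructor
    · intro h X x hx
      exact (t.mem_apply_iff X x).2 (h ((s.mem_apply_iff X x).1 hx))
    · exact fun h I hI => h _ hI

theorem FlatOver.map_elemColon {T : Subring K} (h : FlatOver A T) (X : Submodule A K) (x : K) :
    (elemColon X x).map (Subring.inclusion h.1) = elemColon (extend T X) x := by
  refine le_antisymm (Ideal.map_le_iff_le_comap.2 fun a ha => Submodule.subset_span ha) ?_
  intro t ht
  rw [mem_map_inclusion_iff]
  have h1 := h.covers_colon X (y := t * x) ht
  have h2 : Covers {a | a ∈ A ∧ a * t ∈ A ∧ a * (t * x) ∈ X} T := by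
    refine (h.2 t t.2).mul h1 fun a ha b hb => ⟨A.mul_mem ha.1 hb.1, ?_, ?_⟩
    · rw [mul_right_comm]
      exact A.mul_mem ha.2 hb.1
    · rw [mul_assoc]
      exact X.smul_mem (⟨a, ha.1⟩ : A) hb.2
  refine h2.mem_span fun a ha => Submodule.subset_span ⟨⟨a * t, ha.2.1⟩, ?_, mul_comm _ _⟩
  have := ha.2.2
  rw [← mul_assoc] at this
  exact this

theorem mem_restrict {T : Subring K} (h : A ≤ T) {J : Submodule T K} {x : K} :
    x ∈ restrict h J ↔ x ∈ J := Iff.rfl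

theorem elemColon_restrict {T : Subring K} (h : A ≤ T) (J : Submodule T K) (x : K) :
    elemColon (restrict h J) x = (elemColon J x).comap (Subring.inclusion h) := rfl

end Semistar

/-! ### The decomposition of stable semistar operations -/

section SemistarTheorem

variable {K : Type u} [Field K] {D : Subring K} {Θ : Set (Subring K)}

theorem semistar_apply_eq_iInf (hΘ : IsPreJaffardFamily D Θ) (h : IsCompactFamily D Θ)
    (α : Ordinal.{v}) (s : StableSemistar D) (I : Submodule D K) :
    s I = ⨅ T : truncation D Θ α,
      s (restrict (hΘ.le_of_mem_truncation T.2) (extend T.1 I)) := by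
  refine le_antisymm (le_iInf fun T => s.mono' _ _ fun x hx => Submodule.subset_span hx) ?_
  intro x hx
  rw [s.mem_apply_iff_gabriel]
  refine h.mem_of_saturation_mem α _ _ fun T hT hT' => ?_
  have hxT := (Submodule.mem_iInf _).1 hx ⟨T, hT'⟩
  rw [s.mem_apply_iff_gabriel, elemColon_restrict,
    ← (h.flatOver_of_mem_truncation hT').map_elemColon] at hxT
  exact hxT

/-- Stable semistar operations on `D` correspond to families of stable semistar operations on the
rings in the truncation. -/
def stableSemistarIso (hΘ : IsPreJaffardFamily D Θ) (h : IsCompactFamily D Θ) (α : Ordinal.{v}) :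
    StableSemistar D ≃o ((T : truncation D Θ α) → StableSemistar T.1) where
  toFun s T := (gabrielIso hΘ h α s.gabriel T).semistar
  invFun t := ((gabrielIso hΘ h α).symm fun T => (t T).gabriel).semistar
  left_inv s := by
    have : (fun T => (gabrielIso hΘ h α s.gabriel T).semistar.gabriel) =
        gabrielIso hΘ h α s.gabriel :=
      funext fun T => (semistarIso T.1).apply_symm_apply _
    simp only [this, OrderIso.symm_apply_apply]
    exact (semistarIso D).symm_apply_apply s
  right_inv t := by
    funext T
    have : ((gabrielIso hΘ h α).symm fun T => (t T).gabriel).semistar.gabriel = _ :=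
      (semistarIso D).apply_symm_apply _
    simp only [this, OrderIso.apply_symm_apply]
    exact (semistarIso T.1).symm_apply_apply (t T)
  map_rel_iff' := by
    intro s t
    rw [← (semistarIso D).le_iff_le, ← (gabrielIso hΘ h α).le_iff_le]
    exact forall_congr' fun T => (semistarIso T.1).symm.le_iff_le

theorem stableSemistarIso_apply (hΘ : IsPreJaffardFamily D Θ) (h : IsCompactFamily D Θ)
    (α : Ordinal.{v}) (s : StableSemistar D) (T : truncation D Θ α) (J : Submodule T.1 K) :
    restrict (hΘ.le_of_mem_truncation T.2) (stableSemistarIso hΘ h α s T J) =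
      s (restrict (hΘ.le_of_mem_truncation T.2) J) := by
  ext x
  rw [s.mem_apply_iff_gabriel, elemColon_restrict]
  rfl

theorem stableSemistarIso_symm_apply (hΘ : IsPreJaffardFamily D Θ) (h : IsCompactFamily D Θ)
    (α : Ordinal.{v}) (t : (T : truncation D Θ α) → StableSemistar T.1) (I : Submodule D K) :
    (stableSemistarIso hΘ h α).symm t I = ⨅ T : truncation D Θ α,
      restrict (hΘ.le_of_mem_truncation T.2) (t T (extend T.1 I)) := by
  ext x
  rw [Submodule.mem_iInf]
  refine forall_congr' fun T => ?_
  rw [mem_restrict, (t T).mem_apply_iff_gabriel,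
    ← (h.flatOver_of_mem_truncation T.2).map_elemColon]

end SemistarTheorem

/-! ### Torsion modules of a Gabriel filter -/

section Torsion

/-- Each element of `M` is annihilated by an ideal that belongs to `F`. -/
def GabrielFilter.IsTorsion {R : Type*} [CommRing R] (F : GabrielFilter R) (M : Type*)
    [AddCommGroup M] [Module R M] : Prop :=
  ∀ m : M, elemColon (⊥ : Submodule R M) m ∈ F

namespace GabrielFilter

variable {R : Type*} [CommRing R] (F : GabrielFilter R) {M N P : Type*} [AddCommGroup M]
  [Module R M] [AddCommGroup N] [Module R N] [AddCommGroup P] [Module R P]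

theorem isTorsion_iff_of_span_eq_top {s : Set M} (hs : Submodule.span R s = ⊤) :
    F.IsTorsion M ↔ ∀ m ∈ s, elemColon (⊥ : Submodule R M) m ∈ F := by
  refine ⟨fun h m _ => h m, fun h m => ?_⟩
  have hm : m ∈ Submodule.span R s := hs ▸ Submodule.mem_top
  induction hm using Submodule.span_induction with
  | mem x hx => exact h x hx
  | zero => exact F.mono F.top_mem fun a _ => by rw [mem_elemColon, smul_zero]; exact zero_mem _
  | add x y _ _ hx hy =>
    refine F.mono (F.inf_mem hx hy) fun a ha => ?_
    rw [mem_elemColon, smul_add]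
    exact add_mem ha.1 ha.2
  | smul t x _ hx =>
    refine F.mono hx fun a ha => ?_
    rw [mem_elemColon, smul_comm]
    exact Submodule.smul_mem _ t ha

theorem elemColon_bot_map (f : M →ₗ[R] N) (m : M) :
    elemColon (⊥ : Submodule R M) m ≤ elemColon (⊥ : Submodule R N) (f m) := fun a ha => by
  rw [mem_elemColon, Submodule.mem_bot] at ha ⊢
  rw [← map_smul, ha, map_zero]

theorem elemColon_bot_map_of_injective {f : M →ₗ[R] N} (hf : Function.Injective f) (m : M) :
    elemColon (⊥ : Submodule R N) (f m) = elemColon (⊥ : Submodule R M) m := by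
  refine le_antisymm (fun a ha => ?_) (elemColon_bot_map f m)
  rw [mem_elemColon, Submodule.mem_bot] at ha ⊢
  exact hf (by rw [map_smul, ha, map_zero])

variable {F} in
theorem IsTorsion.of_injective (h : F.IsTorsion N) {f : M →ₗ[R] N} (hf : Function.Injective f) :
    F.IsTorsion M :=
  fun m => elemColon_bot_map_of_injective hf m ▸ h (f m)

variable {F} in
theorem IsTorsion.of_surjective (h : F.IsTorsion M) {f : M →ₗ[R] N} (hf : Function.Surjective f) :
    F.IsTorsion N := fun n => by
  obtain ⟨m, rfl⟩ := hf n
  exact F.mono (h m) (elemColon_bot_map f m)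

/-- Closure under extensions is the Gabriel axiom applied to the annihilator of the image in `P`. -/
theorem isTorsion_iff_of_exact {f : M →ₗ[R] N} {g : N →ₗ[R] P} (hf : Function.Injective f)
    (hg : Function.Surjective g) (hfg : Function.Exact f g) :
    F.IsTorsion N ↔ F.IsTorsion M ∧ F.IsTorsion P := by
  refine ⟨fun h => ⟨h.of_injective hf, h.of_surjective hg⟩, fun h n => ?_⟩
  refine F.mem_of_forall_elemColon (h.2 (g n)) fun y hy => ?_
  rw [mem_elemColon, Submodule.mem_bot, ← map_smul] at hy
  obtain ⟨m, hm⟩ := (hfg _).1 hy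
  refine F.mono (h.1 m) fun a ha => ?_
  rw [mem_elemColon, Submodule.mem_bot] at ha
  rw [mem_elemColon, mem_elemColon, Submodule.mem_bot, smul_eq_mul, mul_smul, ← hm, ← map_smul, ha,
    map_zero]

theorem elemColon_bot_mk (I : Ideal R) (r : R) :
    elemColon (⊥ : Submodule R (R ⧸ I)) (Submodule.Quotient.mk r) = elemColon I r := by
  ext a
  rw [mem_elemColon, mem_elemColon, Submodule.mem_bot, ← Submodule.Quotient.mk_smul,
    Submodule.Quotient.mk_eq_zero]

/-- The map from the cyclic module on the annihilator of `m` that sends `1` to `m`. -/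
def liftElemColon (m : M) : (R ⧸ elemColon (⊥ : Submodule R M) m) →ₗ[R] M :=
  Submodule.liftQ _ (LinearMap.toSpanSingleton R M m) fun _ ha => (Submodule.mem_bot R).1 ha

theorem liftElemColon_mk (m : M) (r : R) :
    liftElemColon m (Submodule.Quotient.mk r) = r • m := rfl

theorem liftElemColon_injective (m : M) : Function.Injective (liftElemColon (R := R) m) := by
  rw [injective_iff_map_eq_zero]
  intro x hx
  obtain ⟨r, rfl⟩ := Submodule.Quotient.mk_surjective _ x
  rw [Submodule.Quotient.mk_eq_zero, mem_elemColon]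
  exact (Submodule.mem_bot R).2 hx

theorem isTorsion_quotient_iff (I : Ideal R) : F.IsTorsion (R ⧸ I) ↔ I ∈ F := by
  constructor
  · intro h
    have := h (Submodule.Quotient.mk 1)
    rw [elemColon_bot_mk] at this
    refine F.mono this fun a ha => ?_
    rwa [mem_elemColon, smul_eq_mul, mul_one] at ha
  · intro h x
    obtain ⟨r, rfl⟩ := Submodule.Quotient.mk_surjective I x
    rw [elemColon_bot_mk]
    exact F.mono h (le_elemColon I r)

end GabrielFilter

end Torsion

/-! ### Singular length functions as Gabriel filters -/

section Length

open CategoryTheory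

variable {R : Type u} [CommRing R]

namespace LengthFunction

variable (ℓ : LengthFunction R) {M N P : Type u} [AddCommGroup M] [Module R M] [AddCommGroup N]
  [Module R N] [AddCommGroup P] [Module R P]

theorem eq_add_of_exact {f : M →ₗ[R] N} {g : N →ₗ[R] P} (hf : Function.Injective f)
    (hg : Function.Surjective g) (hfg : Function.Exact f g) :
    ℓ (ModuleCat.of R N) = ℓ (ModuleCat.of R M) + ℓ (ModuleCat.of R P) := by
  let S : ShortComplex (ModuleCat.{u} R) :=
    ShortComplex.mk (ModuleCat.ofHom f) (ModuleCat.ofHom g) (by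
      ext x
      exact hfg.apply_apply_eq_zero x)
  exact ℓ.additive' S (ModuleCat.shortComplex_shortExact S hfg hf hg)

theorem eq_zero_of_injective {f : M →ₗ[R] N} (hf : Function.Injective f)
    (h : ℓ (ModuleCat.of R N) = 0) : ℓ (ModuleCat.of R M) = 0 := by
  rw [ℓ.eq_add_of_exact hf (Submodule.mkQ_surjective (LinearMap.range f))
    (LinearMap.exact_map_mkQ_range f)] at h
  exact (add_eq_zero.1 h).1

theorem eq_zero_of_surjective {f : M →ₗ[R] N} (hf : Function.Surjective f)
    (h : ℓ (ModuleCat.of R M) = 0) : ℓ (ModuleCat.of R N) = 0 := by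
  rw [ℓ.eq_add_of_exact (LinearMap.ker f).injective_subtype hf
    (LinearMap.exact_subtype_ker_map f)] at h
  exact (add_eq_zero.1 h).2

/-- Upper continuity reduces to finitely generated submodules, which are built from cyclic ones by
sums, each a quotient of a direct sum. -/
theorem eq_zero_iff (M : ModuleCat.{u} R) :
    ℓ M = 0 ↔ ∀ m : M, ℓ (ModuleCat.of R (R ⧸ elemColon (⊥ : Submodule R M) m)) = 0 := by
  constructor
  · exact fun h m => ℓ.eq_zero_of_injective (GabrielFilter.liftElemColon_injective m) h
  · intro h
    rw [ℓ.upperContinuous', ENNReal.iSup_eq_zero]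
    rintro ⟨N, hN⟩
    change ℓ (ModuleCat.of R N) = 0
    induction N, hN using Submodule.fg_induction with
    | singleton m =>
      refine ℓ.eq_zero_of_surjective (f := LinearMap.codRestrict (Submodule.span R {m})
        (GabrielFilter.liftElemColon m) ?_) ?_ (h m)
      · intro x
        obtain ⟨r, rfl⟩ := Submodule.Quotient.mk_surjective _ x
        exact Submodule.smul_mem _ r (Submodule.mem_span_singleton_self m)
      · rintro ⟨x, hx⟩
        obtain ⟨r, rfl⟩ := Submodule.mem_span_singleton.1 hx
        exact ⟨Submodule.Quotient.mk r, rfl⟩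
    | sup N₁ N₂ _ _ h₁ h₂ =>
      have hprod : ℓ (ModuleCat.of R (N₁ × N₂)) = 0 := by
        rw [ℓ.eq_add_of_exact (f := LinearMap.inl R N₁ N₂) (g := LinearMap.snd R N₁ N₂)
          LinearMap.inl_injective LinearMap.snd_surjective Function.Exact.inl_snd, h₁, h₂, add_zero]
      refine ℓ.eq_zero_of_surjective (f := LinearMap.coprod
        (Submodule.inclusion (le_sup_left : N₁ ≤ N₁ ⊔ N₂))
        (Submodule.inclusion (le_sup_right : N₂ ≤ N₁ ⊔ N₂))) ?_ hprod
      rintro ⟨x, hx⟩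
      obtain ⟨y, hy, z, hz, rfl⟩ := Submodule.mem_sup.1 hx
      exact ⟨(⟨y, hy⟩, ⟨z, hz⟩), rfl⟩

theorem eq_zero_quotient_mono {I J : Ideal R} (h : I ≤ J) (hI : ℓ (ModuleCat.of R (R ⧸ I)) = 0) :
    ℓ (ModuleCat.of R (R ⧸ J)) = 0 :=
  ℓ.eq_zero_of_surjective (f := Submodule.factor h) (Submodule.factor_surjective h) hI

/-- The Gabriel filter of the ideals `I` with `ℓ(R/I) = 0`. -/
def gabriel (hℓ : ∃ M, ℓ M ≠ 0) : GabrielFilter R where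
  sets := {I | ℓ (ModuleCat.of R (R ⧸ I)) = 0}
  top_mem' := ℓ.zero' _ (Submodule.Quotient.subsingleton_iff.2 rfl)
  mono' _ _ hI h := ℓ.eq_zero_quotient_mono h hI
  gabriel' J hJ I h := by
    -- Split `R/I` along `N = (I + J)/I`: elements of `N` have annihilators `(I : y)` with `y ∈ J`,
    -- and the quotient is an image of `R/J`.
    let N : Submodule R (R ⧸ I) := Submodule.map (Submodule.mkQ I) J
    change ℓ (ModuleCat.of R (R ⧸ I)) = 0
    rw [ℓ.eq_add_of_exact N.injective_subtype (Submodule.mkQ_surjective N)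
      (LinearMap.exact_subtype_mkQ N)]
    have h1 : ℓ (ModuleCat.of R N) = 0 := by
      rw [ℓ.eq_zero_iff]
      rintro ⟨_, y, hy, rfl⟩
      have : elemColon (⊥ : Submodule R N) ⟨Submodule.mkQ I y, y, hy, rfl⟩ = elemColon I y := by
        rw [← GabrielFilter.elemColon_bot_map_of_injective N.injective_subtype]
        exact GabrielFilter.elemColon_bot_mk I y
      exact this ▸ h y hy
    have h2 : ℓ (ModuleCat.of R ((R ⧸ I) ⧸ N)) = 0 := by
      refine ℓ.eq_zero_of_surjective (f := Submodule.mapQ J N (Submodule.mkQ I)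
        (Submodule.le_comap_map _ _)) ?_ hJ
      intro x
      obtain ⟨x, rfl⟩ := Submodule.Quotient.mk_surjective _ x
      obtain ⟨x, rfl⟩ := Submodule.Quotient.mk_surjective _ x
      exact ⟨Submodule.Quotient.mk x, rfl⟩
    rw [h1, h2, add_zero]
  bot_notMem' h := by
    obtain ⟨M, hM⟩ := hℓ
    exact hM ((ℓ.eq_zero_iff M).2 fun m => ℓ.eq_zero_quotient_mono bot_le h)

theorem eq_zero_iff_isTorsion (hℓ : ∃ M, ℓ M ≠ 0) (M : ModuleCat.{u} R) :
    ℓ M = 0 ↔ (ℓ.gabriel hℓ).IsTorsion M :=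
  ℓ.eq_zero_iff M

end LengthFunction

open Classical in
/-- The singular length function that vanishes on the `F`-torsion modules. -/
def GabrielFilter.length (F : GabrielFilter R) : LengthFunction R where
  toFun M := if F.IsTorsion M then 0 else ∞
  zero' M hM := if_pos fun m => F.mono F.top_mem fun a _ => by
    rw [mem_elemColon, Submodule.mem_bot]
    exact Subsingleton.elim _ _
  additive' S hS := by
    have := F.isTorsion_iff_of_exact (f := S.f.hom) (g := S.g.hom) hS.moduleCat_injective_f
      hS.moduleCat_surjective_g
      ((ShortComplex.ShortExact.moduleCat_exact_iff_function_exact S).1 hS.exact)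
    by_cases h1 : F.IsTorsion S.X₁ <;> by_cases h3 : F.IsTorsion S.X₃ <;> simp [this, h1, h3]
  upperContinuous' M := by
    by_cases h : F.IsTorsion M
    · rw [if_pos h, eq_comm, ENNReal.iSup_eq_zero]
      exact fun N => if_pos (h.of_injective N.1.injective_subtype)
    · rw [if_neg h, eq_comm, eq_top_iff]
      obtain ⟨m, hm⟩ := not_forall.1 h
      refine le_iSup_of_le ⟨Submodule.span R {m}, Submodule.fg_span_singleton m⟩ ?_
      rw [if_neg fun h' => hm ?_]
      have := h' ⟨m, Submodule.mem_span_singleton_self m⟩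
      rwa [← GabrielFilter.elemColon_bot_map_of_injective
        (Submodule.span R {m}).injective_subtype] at this

open Classical in
theorem GabrielFilter.length_eq_zero_iff (F : GabrielFilter R) (M : ModuleCat.{u} R) :
    F.length M = 0 ↔ F.IsTorsion M := by
  change (if _ then _ else _) = _ ↔ _
  split_ifs with h <;> simp [h]

open Classical in
theorem GabrielFilter.length_isSingular (F : GabrielFilter R) : F.length.IsSingular := fun M => by
  change (if _ then _ else _) = _ ∨ (if _ then _ else _) = _
  split_ifs <;> simp

/-- `GabrielFilter.length` as a nonzero singular length function. -/
def GabrielFilter.singularLength (F : GabrielFilter R) : SingularLength R :=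
  ⟨F.length, F.length_isSingular, ModuleCat.of R (R ⧸ (⊥ : Ideal R)), fun h =>
    F.bot_notMem ((F.isTorsion_quotient_iff ⊥).1 ((F.length_eq_zero_iff _).1 h))⟩

/-- The Gabriel filter of a nonzero singular length function. -/
def SingularLength.gabriel (ℓ : SingularLength R) : GabrielFilter R :=
  ℓ.1.gabriel ℓ.2.2

theorem SingularLength.eq_zero_iff (ℓ : SingularLength R) (M : ModuleCat.{u} R) :
    ℓ.1 M = 0 ↔ ℓ.gabriel.IsTorsion M :=
  ℓ.1.eq_zero_iff_isTorsion ℓ.2.2 M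

theorem LengthFunction.IsSingular.le_of_eq_zero {ℓ ℓ' : LengthFunction R} (h : ℓ'.IsSingular)
    {M : ModuleCat.{u} R} (h0 : ℓ' M = 0 → ℓ M = 0) : ℓ M ≤ ℓ' M := by
  rcases h M with h | h
  · rw [h0 h]; exact zero_le
  · rw [h]; exact le_top

/-- The order is reversed: a smaller length function vanishes on more modules. -/
theorem SingularLength.gabriel_le_iff {ℓ ℓ' : SingularLength R} :
    ℓ'.gabriel ≤ ℓ.gabriel ↔ ℓ ≤ ℓ' := by
  constructor
  · intro h M
    refine ℓ'.2.1.le_of_eq_zero fun h0 => ?_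
    rw [SingularLength.eq_zero_iff] at h0 ⊢
    exact fun m => h (h0 m)
  · intro h I hI
    exact le_antisymm ((h (ModuleCat.of R (R ⧸ I))).trans_eq hI) zero_le

theorem SingularLength.singularLength_gabriel (ℓ : SingularLength R) :
    ℓ.gabriel.singularLength = ℓ := by
  apply Subtype.ext
  apply LengthFunction.ext
  funext M
  have h := (ℓ.gabriel.length_eq_zero_iff M).trans (ℓ.eq_zero_iff M).symm
  exact le_antisymm (ℓ.2.1.le_of_eq_zero h.2) (ℓ.gabriel.length_isSingular.le_of_eq_zero h.1)

theorem GabrielFilter.gabriel_singularLength (F : GabrielFilter R) :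
    F.singularLength.gabriel = F := by
  apply GabrielFilter.ext
  ext I
  exact (F.length_eq_zero_iff _).trans (F.isTorsion_quotient_iff I)

end Length

/-! ### Annihilators and torsion under flat base change -/

section Tensor

open TensorProduct

/-- With `I` the annihilator of `m`, flatness keeps `R/I → M` injective after tensoring, and `S ⊗
R/I` is `S/IS`. -/
theorem elemColon_one_tmul {R S : Type*} [CommRing R] [CommRing S] [Algebra R S] [Module.Flat R S]
    {M : Type*} [AddCommGroup M] [Module R M] (m : M) :
    elemColon (⊥ : Submodule S (S ⊗[R] M)) (1 ⊗ₜ m) =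
      (elemColon (⊥ : Submodule R M) m).map (algebraMap R S) := by
  refine le_antisymm (fun s hs => ?_) (Ideal.map_le_iff_le_comap.2 fun a ha => ?_)
  · rw [mem_elemColon, Submodule.mem_bot, smul_tmul', smul_eq_mul, mul_one] at hs
    let f := GabrielFilter.liftElemColon (R := R) m
    have hf : Function.Injective (LinearMap.lTensor S f) :=
      Module.Flat.lTensor_preserves_injective_linearMap f (GabrielFilter.liftElemColon_injective m)
    have h1 : s ⊗ₜ[R] (Submodule.Quotient.mk 1 : R ⧸ elemColon (⊥ : Submodule R M) m) = 0 := by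
      apply hf
      rw [LinearMap.lTensor_tmul, GabrielFilter.liftElemColon_mk, one_smul, hs, map_zero]
    have h3 : (Submodule.Quotient.mk ((1 : R) • s) : S ⧸ (elemColon (⊥ : Submodule R M) m •
        (⊤ : Submodule R S))) = 0 := by
      rw [← map_zero (tensorQuotEquivQuotSMul S (elemColon (⊥ : Submodule R M) m)), ← h1]
      exact (tensorQuotEquivQuotSMul_tmul_mk (elemColon (⊥ : Submodule R M) m) s 1).symm
    rw [one_smul, Submodule.Quotient.mk_eq_zero, Ideal.smul_top_eq_map] at h3
    exact h3
  · rw [mem_elemColon, Submodule.mem_bot] at ha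
    rw [Ideal.mem_comap, mem_elemColon, Submodule.mem_bot, algebraMap_smul, ← tmul_smul, ha,
      tmul_zero]

theorem span_range_one_tmul {R S : Type*} [CommRing R] [CommRing S] [Algebra R S]
    {M : Type*} [AddCommGroup M] [Module R M] :
    Submodule.span S (Set.range fun m : M => (1 : S) ⊗ₜ[R] m) = ⊤ := by
  rw [eq_top_iff]
  intro z _
  induction z using TensorProduct.induction_on with
  | zero => exact zero_mem _
  | tmul s m =>
    have : s ⊗ₜ[R] m = s • ((1 : S) ⊗ₜ[R] m) := by rw [smul_tmul', smul_eq_mul, mul_one]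
    rw [this]
    exact Submodule.smul_mem _ s (Submodule.subset_span ⟨m, rfl⟩)
  | add x y hx hy => exact add_mem (hx trivial) (hy trivial)

theorem GabrielFilter.isTorsion_tensor_iff {R S : Type*} [CommRing R] [CommRing S] [Algebra R S]
    [Module.Flat R S] (G : GabrielFilter S) (M : Type*) [AddCommGroup M] [Module R M] :
    G.IsTorsion (S ⊗[R] M) ↔
      ∀ m : M, (elemColon (⊥ : Submodule R M) m).map (algebraMap R S) ∈ G := by
  rw [G.isTorsion_iff_of_span_eq_top (span_range_one_tmul (R := R)), Set.forall_mem_range]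
  simp only [elemColon_one_tmul]

theorem GabrielFilter.isTorsion_extendScalars_iff {R S : Type u} [CommRing R] [CommRing S]
    {φ : R →+* S} (hφ : φ.Flat) (G : GabrielFilter S) (M : ModuleCat.{u} R) :
    G.IsTorsion ((ModuleCat.extendScalars φ).obj M) ↔
      ∀ m : M, (elemColon (⊥ : Submodule R M) m).map φ ∈ G := by
  let := φ.toAlgebra
  have : Module.Flat R S := hφ
  exact G.isTorsion_tensor_iff M

theorem GabrielFilter.isTorsion_restrictScalars_iff {R S : Type u} [CommRing R] [CommRing S]
    {φ : R →+* S} (hφ : Function.Injective φ) (F : GabrielFilter R) (M : ModuleCat.{u} S) :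
    F.IsTorsion ((ModuleCat.restrictScalars φ).obj M) ↔ (F.comapInv φ hφ).IsTorsion M :=
  Iff.rfl

end Tensor

/-! ### The decomposition of singular length functions -/

section LengthTheorem

variable {K : Type u} [Field K] {D : Subring K} {Θ : Set (Subring K)}

theorem eq_tsum_of_eq_zero_iff {ι : Type*} {f : ι → ℝ≥0∞} {c : ℝ≥0∞}
    (hf : ∀ i, f i = 0 ∨ f i = ∞) (hc : c = 0 ∨ c = ∞) (h : c = 0 ↔ ∀ i, f i = 0) :
    c = ∑' i, f i := by
  rcases hc with hc | hc
  · rw [hc, eq_comm, ENNReal.tsum_eq_zero]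
    exact h.1 hc
  · have : ¬ ∀ i, f i = 0 := fun h0 => by
      rw [h.2 h0] at hc
      exact ENNReal.top_ne_zero hc.symm
    obtain ⟨i, hi⟩ := not_forall.1 this
    rw [hc, eq_comm]
    exact ENNReal.tsum_eq_top_of_eq_top ⟨i, (hf i).resolve_left hi⟩

theorem length_eq_tsum (hΘ : IsPreJaffardFamily D Θ) (h : IsCompactFamily D Θ)
    (α : Ordinal.{v}) (ℓ : LengthFunction D) (hℓ : ℓ.IsSingular) (M : ModuleCat.{u} D) :
    ℓ M = ∑' T : truncation D Θ α,
      ℓ (restrictModule (hΘ.le_of_mem_truncation T.2)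
        (extendModule (hΘ.le_of_mem_truncation T.2) M)) := by
  refine eq_tsum_of_eq_zero_iff (fun T => hℓ _) (hℓ M) ?_
  -- The zero length function has no associated filter avoiding `⊥` and is treated apart.
  by_cases h0 : ∃ M, ℓ M ≠ 0
  · have key : ∀ T : truncation D Θ α, ℓ (restrictModule (hΘ.le_of_mem_truncation T.2)
        (extendModule (hΘ.le_of_mem_truncation T.2) M)) = 0 ↔
        ∀ m : M, saturation (elemColon (⊥ : Submodule D M) m) T.1
          (hΘ.le_of_mem_truncation T.2) ∈ ℓ.gabriel h0 := fun T => by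
      rw [ℓ.eq_zero_iff_isTorsion h0, GabrielFilter.isTorsion_restrictScalars_iff
        (Subring.inclusion_injective _), GabrielFilter.isTorsion_extendScalars_iff
        (h.flatOver_of_mem_truncation T.2).flat]
      rfl
    simp only [key]
    rw [ℓ.eq_zero_iff_isTorsion h0]
    constructor
    · exact fun hM T m => (ℓ.gabriel h0).mono (hM m) (le_saturation _ _)
    · exact fun hM m => h.mem_of_saturation_mem α _ _ fun T _ hT' => hM ⟨T, hT'⟩ m
  · push Not at h0
    simp [h0]

/-- Nonzero singular length functions on `D` correspond to families of such functions on the rings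
in the truncation. -/
def singularLengthIso (hΘ : IsPreJaffardFamily D Θ) (h : IsCompactFamily D Θ) (α : Ordinal.{v}) :
    SingularLength D ≃o ((T : truncation D Θ α) → SingularLength T.1) where
  toFun ℓ T := (gabrielIso hΘ h α ℓ.gabriel T).singularLength
  invFun l := ((gabrielIso hΘ h α).symm fun T => (l T).gabriel).singularLength
  left_inv ℓ := by
    simp only [GabrielFilter.gabriel_singularLength]
    rw [OrderIso.symm_apply_apply]
    exact ℓ.singularLength_gabriel
  right_inv l := by
    funext T
    simp only [GabrielFilter.gabriel_singularLength, OrderIso.apply_symm_apply]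
    exact (l T).singularLength_gabriel
  map_rel_iff' := by
    intro ℓ ℓ'
    -- The order is reversed in passing to filters and again in passing back.
    rw [← SingularLength.gabriel_le_iff, ← (gabrielIso hΘ h α).le_iff_le]
    refine forall_congr' fun T => ?_
    change GabrielFilter.singularLength _ ≤ GabrielFilter.singularLength _ ↔ _
    rw [← SingularLength.gabriel_le_iff, GabrielFilter.gabriel_singularLength,
      GabrielFilter.gabriel_singularLength]

theorem singularLengthIso_apply (hΘ : IsPreJaffardFamily D Θ) (h : IsCompactFamily D Θ)
    (α : Ordinal.{v}) (ℓ : SingularLength D) (T : truncation D Θ α) (M : ModuleCat.{u} T.1) :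
    (singularLengthIso hΘ h α ℓ T).1 M =
      ℓ.1 (restrictModule (hΘ.le_of_mem_truncation T.2) M) := by
  have key : (singularLengthIso hΘ h α ℓ T).1 M = 0 ↔
      ℓ.1 (restrictModule (hΘ.le_of_mem_truncation T.2) M) = 0 := by
    rw [ℓ.eq_zero_iff, GabrielFilter.isTorsion_restrictScalars_iff
      (Subring.inclusion_injective _)]
    exact GabrielFilter.length_eq_zero_iff _ M
  rcases ℓ.2.1 (restrictModule (hΘ.le_of_mem_truncation T.2) M) with h0 | h0
  · rw [h0, key.2 h0]
  · rw [h0]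
    refine ((singularLengthIso hΘ h α ℓ T).2.1 M).resolve_left fun h1 => ?_
    rw [key.1 h1] at h0
    exact ENNReal.top_ne_zero h0.symm

theorem singularLengthIso_symm_apply (hΘ : IsPreJaffardFamily D Θ) (h : IsCompactFamily D Θ)
    (α : Ordinal.{v}) (l : (T : truncation D Θ α) → SingularLength T.1) (M : ModuleCat.{u} D) :
    ((singularLengthIso hΘ h α).symm l).1 M = ∑' T : truncation D Θ α,
      (l T).1 (extendModule (hΘ.le_of_mem_truncation T.2) M) := by
  refine eq_tsum_of_eq_zero_iff (fun T => (l T).2.1 _)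
    (((singularLengthIso hΘ h α).symm l).2.1 M) ?_
  have key : ∀ T : truncation D Θ α,
      (l T).1 (extendModule (hΘ.le_of_mem_truncation T.2) M) = 0 ↔
        ∀ m : M, (elemColon (⊥ : Submodule D M) m).map
          (Subring.inclusion (hΘ.le_of_mem_truncation T.2)) ∈ (l T).gabriel := fun T => by
    rw [(l T).eq_zero_iff, GabrielFilter.isTorsion_extendScalars_iff
      (h.flatOver_of_mem_truncation T.2).flat]
  simp only [key]
  refine (GabrielFilter.length_eq_zero_iff _ M).trans ?_
  exact ⟨fun hM T m => hM m T, fun hM m T => hM T m⟩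

end LengthTheorem

end PreJaffard

end

theorem mainTheorem2 {K : Type u} [Field K] (D : Subring K) [IsFractionRing D K]
    (Θ : Set (Subring K)) (hΘ : IsPreJaffardFamily D Θ) (α : Ordinal.{v}) :
    -- `I^⋆ = ⋂_{T ∈ Θ'} (IT)^⋆`
    (∀ (s : StableSemistar D) (I : Submodule D K),
      s I = ⨅ T : truncation D Θ α,
        s (restrict (hΘ.le_of_mem_truncation T.2) (extend T.1 I))) ∧
    -- restriction and extension are inverse order isomorphisms `Stab(D) ≃ ∏ Stab(T)`
    (∃ e : StableSemistar D ≃o ((T : truncation D Θ α) → StableSemistar T.1),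
      (∀ (s : StableSemistar D) (T : truncation D Θ α) (J : Submodule T.1 K),
        restrict (hΘ.le_of_mem_truncation T.2) (e s T J) =
          s (restrict (hΘ.le_of_mem_truncation T.2) J)) ∧
      (∀ (t : (T : truncation D Θ α) → StableSemistar T.1) (I : Submodule D K),
        e.symm t I = ⨅ T : truncation D Θ α,
          restrict (hΘ.le_of_mem_truncation T.2) (t T (extend T.1 I)))) ∧
    -- `ℓ = ∑_{T ∈ Θ'} ℓ ⊗ T` for every singular length function
    (∀ ℓ : LengthFunction D, ℓ.IsSingular → ∀ M : ModuleCat.{u} D,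
      ℓ M = ∑' T : truncation D Θ α,
        ℓ (restrictModule (hΘ.le_of_mem_truncation T.2)
          (extendModule (hΘ.le_of_mem_truncation T.2) M))) ∧
    -- restriction and extension are inverse order isomorphisms for singular length functions
    (∃ e : SingularLength D ≃o ((T : truncation D Θ α) → SingularLength T.1),
      (∀ (ℓ : SingularLength D) (T : truncation D Θ α) (M : ModuleCat.{u} T.1),
        (e ℓ T).1 M = ℓ.1 (restrictModule (hΘ.le_of_mem_truncation T.2) M)) ∧
      (∀ (l : (T : truncation D Θ α) → SingularLength T.1) (M : ModuleCat.{u} D),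
        (e.symm l).1 M = ∑' T : truncation D Θ α,
          (l T).1 (extendModule (hΘ.le_of_mem_truncation T.2) M))) := by
  have h := hΘ.isCompactFamily (exists_mul_mem_of_isFractionRing D)
  exact ⟨semistar_apply_eq_iInf hΘ h α, ⟨stableSemistarIso hΘ h α,
    stableSemistarIso_apply hΘ h α, stableSemistarIso_symm_apply hΘ h α⟩,
    length_eq_tsum hΘ h α, ⟨singularLengthIso hΘ h α, singularLengthIso_apply hΘ h α,
      singularLengthIso_symm_apply hΘ h α⟩⟩
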